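/- **Setting.** Let $0<\alpha<1$, $\theta=\alpha/2$, $\Omega=(x_l,x_r)$, $0<\mu_0\le\mu_1$, $\omega_\beta(t)=t^{\beta-1}/\Gamma(\beta)$, and $E_\alpha(z)=\sum_{k\ge0}z^k/\Gamma(1+k\alpha)$. Let $\mu,c$ be functions on $\Omega$ with $\mu_0\le\mu(x)\le\mu_1$ and $|c(x)|\le\kappa$, where $\kappa\ge0$. *Space.* For $M\ge1$ put $h=(x_r-x_l)/M$, $x_i=x_l+ih$, $\Omega_h=\{x_1,\dots,x_{M-1}\}$, and let $\mathbb V_h$ be the space of grid functions on $\{x_0,\dots,x_M\}$ with $v(x_0)=v(x_M)=0$. For $1\le i\le M-1$ let $$(\mathcal L_hv)(x_i)=-\frac1h\Big(\mu(x_{i+1/2})\tfrac{v(x_{i+1})-v(x_i)}h-\mu(x_{i-1/2})\tfrac{v(x_i)-v(x_{i-1})}h\Big),$$ and let $\langle v,w\rangle=h\sum_{x\in\Omega_h}v(x)w(x)$, $\|v\|=\sqrt{\langle v,v\rangle}$, $|v|_1=\sqrt{\langle v,\mathcal L_hv\rangle}$ and $\|v\|_1=\sqrt{\|v\|^2+|v|_1^2}$.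 *Time.* Let $N\ge1$, $0=t_0<t_1<\dots<t_N=T$, $\tau_k=t_k-t_{k-1}$, $\tau=\max_{1\le k\le N}\tau_k$, $\rho_k=\tau_k/\tau_{k+1}$, $t_{n-\theta}=\theta t_{n-1}+(1-\theta)t_n$, and $v^{n-\theta}=\theta v^{n-1}+(1-\theta)v^n$ for mesh functions $v$. For $1\le k\le n-1$ put $$a^{(n)}_0=\int_{t_{n-1}}^{t_{n-\theta}}\frac{\omega_{1-\alpha}(t_{n-\theta}-s)}{\tau_n}\,ds,\qquad a^{(n)}_{n-k}=\int_{t_{k-1}}^{t_k}\frac{\omega_{1-\alpha}(t_{n-\theta}-s)}{\tau_k}\,ds,$$ $$b^{(n)}_{n-k}=\frac{2}{\tau_k(\tau_k+\tau_{k+1})}\int_{t_{k-1}}^{t_k}\Big(s-\tfrac{t_{k-1}+t_k}2\Big)\omega_{1-\alpha}(t_{n-\theta}-s)\,ds.$$ The Alikhanov kernels are $A^{(1)}_0=a^{(1)}_0$ and, for $n\ge2$, $A^{(n)}_0=a^{(n)}_0+\rho_{n-1}b^{(n)}_1$, $A^{(n)}_{n-k}=a^{(n)}_{n-k}+\rho_{k-1}b^{(n)}_{n-k+1}-b^{(n)}_{n-k}$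 for $2\le k\le n-1$, and $A^{(n)}_{n-1}=a^{(n)}_{n-1}-b^{(n)}_{n-1}$. The complementary kernels are $P^{(n)}_0=1/A^{(n)}_0$ and $$P^{(n)}_{n-j}=\frac1{A^{(j)}_0}\sum_{k=j+1}^n\big(A^{(k)}_{k-j-1}-A^{(k)}_{k-j}\big)P^{(n)}_{n-k}\qquad(1\le j\le n-1).$$ *Scheme.* The fractional Crank–Nicolson scheme with zero boundary values, source $f$ and initial value $u_0$ seeks $u_h^n\in\mathbb V_h$, $0\le n\le N$, with $u_h^0=u_0$ on $\Omega_h$ and $$\sum_{k=1}^nA^{(n)}_{n-k}\big(u_h^k-u_h^{k-1}\big)(x)+(\mathcal L_hu_h^{n-\theta})(x)=c(x)\,u_h^{n-\theta}(x)+f(x,t_{n-\theta})\qquad(x\in\Omega_h,\ 1\le n\le N).$$ Write $f^{n-\theta}$ for the grid function $x\mapsto f(x,t_{n-\theta})$ on $\Omega_h$. **Statement.** There is a constant $C_\Omega>0$, depending only on $\Omega,\mu_0,\mu_1$, such that $\|v\|^2\le C_\Omega|v|_1^2$ for all $M\ge1$, all $v\in\mathbb V_h$ and all $\mu$ with $\mu_0\le\mu\le\mu_1$.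 Let $C_\Omega$ be any such constant. If the mesh satisfies $\rho_k\le 7/4$ for $1\le k\le N-1$ and $$11\,\Gamma(2-\alpha)\,\kappa^2C_\Omega\,\tau^\alpha\le1,$$ then the scheme is stable in the discrete $H^1$ norm, without any relation between the time steps and $h$: for every solution $u_h$ and $1\le n\le N$, $$\begin{aligned}|u_h^n|_1^2&\le2E_\alpha\big(\tfrac{77}4\kappa^2C_\Omega t_n^\alpha\big)\Big(|u_h^0|_1^2+\max_{1\le k\le n}\sum_{j=1}^kP^{(k)}_{k-j}\|f^{j-\theta}\|^2\Big)\\&\le2E_\alpha\big(\tfrac{77}4\kappa^2C_\Omega t_n^\alpha\big)\Big(|u_h^0|_1^2+\tfrac{11}4\Gamma(1-\alpha)\max_{1\le k\le n}\big\{t_k^\alpha\|f^{k-\theta}\|^2\big\}\Big),\end{aligned}$$ and consequently $$\|u_h^n\|_1^2\le2(1+C_\Omega)E_\alpha\big(\tfrac{77}4\kappa^2C_\Omega t_n^\alpha\big)\Big(\|u_h^0\|_1^2+\tfrac{11}4\Gamma(1-\alpha)\max_{1\le k\le n}\big\{t_k^\alpha\|f^{k-\theta}\|^2\big\}\Big).$$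 -/

import Mathlib

namespace FracCN

noncomputable section

/-! ### Special functions -/

/-- The Riemann–Liouville kernel `ω_β(t) = t^(β-1) / Γ(β)`. -/
def omega (β t : ℝ) : ℝ := t ^ (β - 1) / Real.Gamma β

/-- The Mittag-Leffler function `E_α(z) = ∑_{k ≥ 0} z^k / Γ(1 + k α)`. -/
def mittagLeffler (α z : ℝ) : ℝ := ∑' k : ℕ, z ^ k / Real.Gamma (1 + k * α)

/-! ### Nonuniform time meshes -/

/-- `0 = t_0 < t_1 < ⋯ < t_N = T`. Only the values `t k` with `k ≤ N` matter. -/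
structure IsTimeMesh (t : ℕ → ℝ) (N : ℕ) (T : ℝ) : Prop where
  zero : t 0 = 0
  lt_succ : ∀ k, k < N → t k < t (k + 1)
  last : t N = T

/-- The step size `τ_k = t_k - t_{k-1}`, for `k ≥ 1`. -/
def step (t : ℕ → ℝ) (k : ℕ) : ℝ := t k - t (k - 1)

/-- The adjoint step ratio `ρ_k = τ_k / τ_{k+1}`, for `k ≥ 1`. -/
def ratio (t : ℕ → ℝ) (k : ℕ) : ℝ := step t k / step t (k + 1)

/-- The maximum step size `τ = max_{1 ≤ k ≤ N} τ_k`. -/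
def maxStep (t : ℕ → ℝ) (N : ℕ) (hN : 1 ≤ N) : ℝ :=
  (Finset.Icc 1 N).sup' (Finset.nonempty_Icc.2 hN) (step t)

/-- The local mesh restriction `ρ_k ≤ 7/4` for `1 ≤ k ≤ N - 1`. -/
def StepRatioBound (t : ℕ → ℝ) (N : ℕ) : Prop :=
  ∀ k, 1 ≤ k → k + 1 ≤ N → ratio t k ≤ 7 / 4

/-- The weighted average `ν a_{n-1} + (1 - ν) a_n`, for `n ≥ 1`. It gives both the offset time
`t_{n-ν}` and the weighted value `v^{n-ν}` of a mesh function. -/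
def offset (ν : ℝ) (a : ℕ → ℝ) (n : ℕ) : ℝ := ν * a (n - 1) + (1 - ν) * a n

/-! ### The nonuniform Alikhanov formula, with offset `θ = α / 2` -/

/-- The coefficient `a^{(n)}_m`, for `0 ≤ m ≤ n - 1`; with `k = n - m`, it is the average over
`(t_{k-1}, t_k)` (cut off at `t_{n-θ}` if `k = n`, but still divided by `τ_n`) of the kernel
`ω_{1-α}(t_{n-θ} - s)`. -/
def aCoef (α : ℝ) (t : ℕ → ℝ) (n m : ℕ) : ℝ :=
  if m = 0 then
    ∫ s in (t (n - 1))..(offset (α / 2) t n), omega (1 - α) (offset (α / 2) t n - s) / step t n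
  else
    ∫ s in (t (n - m - 1))..(t (n - m)),
      omega (1 - α) (offset (α / 2) t n - s) / step t (n - m)

/-- The coefficient `b^{(n)}_m`, for `1 ≤ m ≤ n - 1`; with `k = n - m`, it is
`2 / (τ_k (τ_k + τ_{k+1})) ∫_{t_{k-1}}^{t_k} (s - t_{k-1/2}) ω_{1-α}(t_{n-θ} - s) ds`. -/
def bCoef (α : ℝ) (t : ℕ → ℝ) (n m : ℕ) : ℝ :=
  2 / (step t (n - m) * (step t (n - m) + step t (n - m + 1))) *
    ∫ s in (t (n - m - 1))..(t (n - m)),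
      (s - (t (n - m - 1) + t (n - m)) / 2) * omega (1 - α) (offset (α / 2) t n - s)

/-- The discrete convolution kernel `A^{(n,θ)}_m` of the Alikhanov formula, for `0 ≤ m ≤ n - 1`. -/
def kernelA (α : ℝ) (t : ℕ → ℝ) (n m : ℕ) : ℝ :=
  if n = 1 then aCoef α t 1 0
  else if m = 0 then aCoef α t n 0 + ratio t (n - 1) * bCoef α t n 1
  else if m = n - 1 then aCoef α t n (n - 1) - bCoef α t n (n - 1)
  else aCoef α t n m + ratio t (n - m - 1) * bCoef α t n (m + 1) - bCoef α t n m

/-- The discrete Caputo derivative `∑_{k=1}^n A^{(n,θ)}_{n-k} (v^k - v^{k-1})`. -/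
def discreteCaputo (α : ℝ) (t : ℕ → ℝ) (v : ℕ → ℝ) (n : ℕ) : ℝ :=
  ∑ k ∈ Finset.Icc 1 n, kernelA α t n (n - k) * (v k - v (k - 1))

/-- The complementary kernel `P^{(n)}_m`, for `0 ≤ m ≤ n - 1`, of a kernel `A`: `P^{(n)}_0 = 1 / A^{(n)}_0`
and, with `j = n - m` and `k = n - i`,
`P^{(n)}_{n-j} = (1 / A^{(j)}_0) ∑_{k=j+1}^n (A^{(k)}_{k-j-1} - A^{(k)}_{k-j}) P^{(n)}_{n-k}`. -/
def complementary (A : ℕ → ℕ → ℝ) (n : ℕ) (m : ℕ) : ℝ :=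
  if m = 0 then 1 / A n 0
  else 1 / A (n - m) 0 *
    ∑ i : Fin m, (A (n - i) (m - i - 1) - A (n - i) (m - i)) * complementary A n i
termination_by m
decreasing_by exact i.isLt

/-! ### The spatial grid on `(xl, xr)` with `M` subintervals

A grid function is a function `v : ℕ → ℝ`, `v i` being its value at `x_i`; only `i ≤ M` matters. -/

/-- The mesh width `h = (xr - xl) / M`. -/
def width (xl xr : ℝ) (M : ℕ) : ℝ := (xr - xl) / M

/-- The point `xl + r h`; the grid points are those with `r = i`, the midpoints those with
`r = i ± 1/2`. -/
def pt (xl xr : ℝ) (M : ℕ) (r : ℝ) : ℝ := xl + r * width xl xr M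

/-- `v` vanishes at the two boundary points, that is, `v ∈ 𝕍_h`. -/
def VanishesOnBoundary (M : ℕ) (v : ℕ → ℝ) : Prop := v 0 = 0 ∧ v M = 0

/-- The difference operator `(𝓛_h v)(x_i)`, for `1 ≤ i ≤ M - 1`, approximating `-∂ₓ(μ ∂ₓ v)`. -/
def Lh (xl xr : ℝ) (μ : ℝ → ℝ) (M : ℕ) (v : ℕ → ℝ) (i : ℕ) : ℝ :=
  -(μ (pt xl xr M (i + 1 / 2)) * ((v (i + 1) - v i) / width xl xr M)
    - μ (pt xl xr M (i - 1 / 2)) * ((v i - v (i - 1)) / width xl xr M)) / width xl xr M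

/-- The discrete inner product `⟨v, w⟩ = h ∑_{i=1}^{M-1} v(x_i) w(x_i)`. -/
def ip (xl xr : ℝ) (M : ℕ) (v w : ℕ → ℝ) : ℝ :=
  width xl xr M * ∑ i ∈ Finset.Ioo 0 M, v i * w i

/-- The discrete `L²` norm `‖v‖ = √⟨v, v⟩`. -/
def normL2 (xl xr : ℝ) (M : ℕ) (v : ℕ → ℝ) : ℝ := √(ip xl xr M v v)

/-- The discrete `H¹` semi-norm `|v|₁ = √⟨v, 𝓛_h v⟩`. -/
def semiH1 (xl xr : ℝ) (μ : ℝ → ℝ) (M : ℕ) (v : ℕ → ℝ) : ℝ :=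
  √(ip xl xr M v (Lh xl xr μ M v))

/-- The discrete `H¹` norm `‖v‖₁ = √(‖v‖² + |v|₁²)`. -/
def normH1 (xl xr : ℝ) (μ : ℝ → ℝ) (M : ℕ) (v : ℕ → ℝ) : ℝ :=
  √(normL2 xl xr M v ^ 2 + semiH1 xl xr μ M v ^ 2)

/-- `C` is a constant in the discrete embedding inequality `‖v‖² ≤ C |v|₁²`, uniformly in the
grid, in the grid functions vanishing on the boundary, and in the diffusion coefficients with
`μ₀ ≤ μ ≤ μ₁`. -/
def IsEmbeddingConst (xl xr μ₀ μ₁ C : ℝ) : Prop :=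
  0 < C ∧ ∀ μ : ℝ → ℝ, (∀ x ∈ Set.Ioo xl xr, μ₀ ≤ μ x ∧ μ x ≤ μ₁) →
    ∀ M : ℕ, 1 ≤ M → ∀ v : ℕ → ℝ, VanishesOnBoundary M v →
      normL2 xl xr M v ^ 2 ≤ C * semiH1 xl xr μ M v ^ 2

/-! ### The fractional Crank–Nicolson scheme -/

/-- `u n i` is the value at `(x_i, t_n)` of a solution of the fractional Crank–Nicolson scheme with
homogeneous Dirichlet boundary values. -/
structure IsSolution (xl xr : ℝ) (μ c : ℝ → ℝ) (f : ℝ → ℝ → ℝ) (u₀ : ℝ → ℝ) (α : ℝ)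
    (t : ℕ → ℝ) (N M : ℕ) (u : ℕ → ℕ → ℝ) : Prop where
  equation : ∀ n, 1 ≤ n → n ≤ N → ∀ i, 0 < i → i < M →
    discreteCaputo α t (fun k => u k i) n
        + Lh xl xr μ M (fun j => offset (α / 2) (fun k => u k j) n) i
      = c (pt xl xr M i) * offset (α / 2) (fun k => u k i) n
        + f (pt xl xr M i) (offset (α / 2) t n)
  boundary : ∀ n, n ≤ N → VanishesOnBoundary M (u n)
  initial : ∀ i, 0 < i → i < M → u 0 i = u₀ (pt xl xr M i)

/-- The squared discrete norm `‖f^{n-θ}‖²` of the grid function `x ↦ f(x, t_{n-θ})`. -/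
def sourceSq (xl xr : ℝ) (f : ℝ → ℝ → ℝ) (α : ℝ) (t : ℕ → ℝ) (M n : ℕ) : ℝ :=
  normL2 xl xr M (fun i => f (pt xl xr M i) (offset (α / 2) t n)) ^ 2

/-- `max_{1 ≤ k ≤ n} g k`. -/
def maxUpTo (n : ℕ) (hn : 1 ≤ n) (g : ℕ → ℝ) : ℝ :=
  (Finset.Icc 1 n).sup' (Finset.nonempty_Icc.2 hn) g

end

end FracCN

namespace FracCN

open Finset

/-! ### Complementary kernels -/

/-! Testing the scheme with `𝓛_h u^{n-θ}` turns it into a scalar fractional Grönwall inequality for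
`V^n = |u^n|₁²`, where no inverse power of `h` appears. The term `-‖𝓛_h u^{n-θ}‖²` absorbs the
pairings with `c u^{n-θ}` and `f` by Young's inequality. The embedding constant and convexity of the
square bound what remains by `κ² C V^{n-θ} + ‖f^{n-θ}‖²`. The discrete derivative paired with `𝓛_h
u^{n-θ}` dominates half the discrete derivative of `V` (`IsMonotoneKernel.energy`), because the
kernel is positive, nonincreasing and satisfies `(1 - θ) A_1 ≤ (1 - 2θ) A_0`.

These kernel properties follow by comparing with point values of `ω_{1-α}`. The value at the node
`t_k` lies between `A_{n-k}` and `A_{n-k-1}` (`kernelA_le_omega`, `omega_le_aCoef_sub_bCoef`), and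
at the last node an exact formula for `a_0` gives the sharper ratio. The kernel also dominates
`4/11` times the cell averages of `ω_{1-α}(t_n - s)` (`integral_omega_le_kernelA`).

The complementary kernel inverts the convolution: `∑_j P_{n-j} A_{j-k} = 1` for each `k`. With the
`4/11` bound and the semigroup law `ω_{1-α} * ω_γ = ω_{1-α+γ}`, it acts on powers of `t` like a
fractional integral, up to the factor `11/4 · 7/4 = 77/16` (`sum_complementary_omega_le`). Summing
over the Mittag-Leffler series shows that `E_α(l t^α)` is a supersolution of the Grönwall recursion
(`mul_sum_complementary_mittagLeffler_le`), and `gronwall` closes the argument by induction on `n`.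
-/

/-- A discrete kernel `A n m`, `m < n ≤ N`, that is positive and nonincreasing in `m`. -/
structure IsMonotoneKernel (A : ℕ → ℕ → ℝ) (N : ℕ) : Prop where
  pos : ∀ n ≤ N, ∀ m < n, 0 < A n m
  anti : ∀ n ≤ N, ∀ m, m + 1 < n → A n (m + 1) ≤ A n m

theorem complementary_zero (A : ℕ → ℕ → ℝ) (n : ℕ) : complementary A n 0 = 1 / A n 0 := by
  rw [complementary]; simp

theorem complementary_succ (A : ℕ → ℕ → ℝ) (n m : ℕ) :
    complementary A n (m + 1) = 1 / A (n - (m + 1)) 0 *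
      ∑ i ∈ range (m + 1), (A (n - i) (m - i) - A (n - i) (m + 1 - i)) * complementary A n i := by
  rw [complementary, if_neg (Nat.succ_ne_zero m), Finset.sum_range]
  congr 1
  refine Finset.sum_congr rfl fun i _ => ?_
  rw [show m + 1 - (i : ℕ) - 1 = m - i by omega]

namespace IsMonotoneKernel

variable {A : ℕ → ℕ → ℝ} {N n : ℕ}

theorem complementary_nonneg (hA : IsMonotoneKernel A N) (hn : n ≤ N) {m : ℕ} (hm : m < n) :
    0 ≤ complementary A n m := by
  induction m using Nat.strong_induction_on with
  | _ m ih =>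
    rcases m with _ | m
    · rw [complementary_zero]
      exact (one_div_pos.2 (hA.pos n hn 0 hm)).le
    · rw [complementary_succ]
      refine mul_nonneg (one_div_pos.2 (hA.pos _ (by omega) 0 (by omega))).le
        (Finset.sum_nonneg fun i hi => ?_)
      have hi' : i < m + 1 := by simpa using hi
      refine mul_nonneg ?_ (ih i hi' (by omega))
      have := hA.anti (n - i) (by omega) (m - i) (by omega)
      rw [show m - i + 1 = m + 1 - i by omega] at this
      linarith

/-- The recursion for `P` is designed for this: the new term restores exactly what the sum loses
when every `A (n - i) (m - i)` is replaced by `A (n - i) (m + 1 - i)`. -/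
theorem sum_range_complementary_mul (hA : IsMonotoneKernel A N) (hn : n ≤ N) {m : ℕ} (hm : m < n) :
    ∑ i ∈ range (m + 1), complementary A n i * A (n - i) (m - i) = 1 := by
  induction m with
  | zero =>
    have := (hA.pos n hn 0 hm).ne'
    simp [complementary_zero, this]
  | succ m ih =>
    rw [Finset.sum_range_succ, complementary_succ, Nat.sub_self]
    have h0 := (hA.pos (n - (m + 1)) (by omega) 0 (by omega)).ne'
    rw [mul_right_comm, one_div_mul_cancel h0, one_mul, ← Finset.sum_add_distrib, ← ih (by omega)]
    exact Finset.sum_congr rfl fun i _ => by ring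

theorem sum_complementary_mul (hA : IsMonotoneKernel A N) (hn : n ≤ N) {k : ℕ} (hk : 1 ≤ k)
    (hkn : k ≤ n) : ∑ j ∈ Icc k n, complementary A n (n - j) * A j (j - k) = 1 := by
  rw [← hA.sum_range_complementary_mul hn (show n - k < n by omega)]
  refine Finset.sum_nbij' (fun j => n - j) (fun i => n - i) ?_ ?_ ?_ ?_ ?_
  · intro j hj; simp only [mem_Icc] at hj; simp only [mem_range]; omega
  · intro j hj; simp only [mem_range] at hj; simp only [mem_Icc]; omega
  · intro j hj; simp only [mem_Icc] at hj; omega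
  · intro j hj; simp only [mem_range] at hj; omega
  · intro j hj
    simp only [mem_Icc] at hj
    rw [show n - (n - j) = j by omega, show n - k - (n - j) = j - k by omega]

theorem sum_complementary_conv (hA : IsMonotoneKernel A N) (hn : n ≤ N) (X : ℕ → ℝ) :
    ∑ j ∈ Icc 1 n, complementary A n (n - j) * ∑ k ∈ Icc 1 j, A j (j - k) * X k
      = ∑ k ∈ Icc 1 n, X k := by
  simp_rw [Finset.mul_sum]
  rw [Finset.sum_comm' (t' := Icc 1 n) (s' := fun k => Icc k n)
    (fun j k => by simp only [mem_Icc]; omega)]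
  refine Finset.sum_congr rfl fun k hk => ?_
  rw [mem_Icc] at hk
  simp_rw [← mul_assoc]
  rw [← Finset.sum_mul, hA.sum_complementary_mul hn hk.1 hk.2, one_mul]

/-- Dropping the term `j = n` leaves total weight at most one on each `X k`. The Grönwall step needs
this form, since its term `j = n` is absorbed on the left. -/
theorem sum_Ico_complementary_conv_le (hA : IsMonotoneKernel A N) (hn : n ≤ N) {X : ℕ → ℝ}
    (hX : ∀ k ∈ Ico 1 n, 0 ≤ X k) :
    ∑ j ∈ Ico 1 n, complementary A n (n - j) * ∑ k ∈ Icc 1 j, A j (j - k) * X k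
      ≤ ∑ k ∈ Ico 1 n, X k := by
  simp_rw [Finset.mul_sum]
  rw [Finset.sum_comm' (t' := Ico 1 n) (s' := fun k => Ico k n)
    (fun j k => by simp only [mem_Icc, mem_Ico]; omega)]
  refine Finset.sum_le_sum fun k hk => ?_
  have hk' := mem_Ico.1 hk
  simp_rw [← mul_assoc]
  rw [← Finset.sum_mul]
  refine mul_le_of_le_one_left (hX k hk) ?_
  rw [← hA.sum_complementary_mul hn hk'.1 hk'.2.le]
  refine Finset.sum_le_sum_of_subset_of_nonneg Ico_subset_Icc_self fun j hj _ => ?_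
  rw [mem_Icc] at hj
  exact mul_nonneg (hA.complementary_nonneg hn (by omega)) (hA.pos j (by omega) _ (by omega)).le

/-- A discrete fractional Grönwall inequality. The Mittag-Leffler weights enter only through the
monotone sequence `E`. -/
theorem gronwall (hA : IsMonotoneKernel A N) {V g E : ℕ → ℝ} {L θ : ℝ} (hV : ∀ n, 0 ≤ V n)
    (hθ : 0 ≤ θ) (hθ' : θ ≤ 1) (hL : 0 ≤ L)
    (hP : ∀ n, 1 ≤ n → n ≤ N → L * complementary A n 0 ≤ 1 / 4)
    (hE1 : ∀ n ≤ N, 1 ≤ E n) (hEmono : ∀ m n, m ≤ n → n ≤ N → E m ≤ E n)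
    (hE : ∀ n, 1 ≤ n → n ≤ N →
      4 * L * ∑ j ∈ Ico 1 n, complementary A n (n - j) * E j ≤ E n - 1)
    (h : ∀ n, 1 ≤ n → n ≤ N → ∑ k ∈ Icc 1 n, A n (n - k) * (V k - V (k - 1))
      ≤ L * offset θ V n + g n)
    {G : ℝ} (hG : V 0 ≤ G) (hn : n ≤ N)
    (hGn : ∀ k, 1 ≤ k → k ≤ n → V 0 + ∑ j ∈ Icc 1 k, complementary A k (k - j) * g j ≤ G) :
    V n ≤ 2 * E n * G := by
  have hG0 : 0 ≤ G := (hV 0).trans hG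
  induction n using Nat.strong_induction_on with
  | _ n ih =>
    rcases Nat.eq_zero_or_pos n with rfl | hn1
    · nlinarith [hE1 0 hn]
    have ih' : ∀ j < n, V j ≤ 2 * E j * G := fun j hj =>
      ih j hj (by omega) fun k hk hkj => hGn k hk (by omega)
    -- If `V` does not increase, the induction hypothesis suffices; otherwise the offset average at
    -- `n` is at most `V n`, so it can be absorbed.
    rcases le_total (V n) (V (n - 1)) with hle | hle
    · have h1 := ih' (n - 1) (by omega)
      have h2 := hEmono (n - 1) n (by omega) hn
      nlinarith
    have htel : ∀ m, ∑ k ∈ Icc 1 m, (V k - V (k - 1)) = V m - V 0 := by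
      intro m
      induction m with
      | zero => simp
      | succ m ihm => rw [Finset.sum_Icc_succ_top (by omega), ihm]; simp
    have hPn : ∀ j ∈ Icc 1 n, 0 ≤ complementary A n (n - j) := fun j hj =>
      hA.complementary_nonneg hn (by rw [mem_Icc] at hj; omega)
    have h1 : V n - V 0 ≤ ∑ j ∈ Icc 1 n, complementary A n (n - j) * (L * offset θ V j + g j) := by
      rw [← htel n, ← hA.sum_complementary_conv hn]
      refine Finset.sum_le_sum fun j hj => mul_le_mul_of_nonneg_left ?_ (hPn j hj)
      rw [mem_Icc] at hj
      exact h j hj.1 (by omega)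
    have h2 : ∑ j ∈ Icc 1 n, complementary A n (n - j) * (L * offset θ V j + g j)
        = (∑ j ∈ Ico 1 n, complementary A n (n - j) * (L * offset θ V j)
          + complementary A n 0 * (L * offset θ V n))
          + ∑ j ∈ Icc 1 n, complementary A n (n - j) * g j := by
      simp_rw [mul_add, Finset.sum_add_distrib]
      rw [← Finset.sum_Ico_add_eq_sum_Icc hn1, Nat.sub_self]
    have h3 : ∑ j ∈ Ico 1 n, complementary A n (n - j) * (L * offset θ V j)
        ≤ 2 * L * G * ∑ j ∈ Ico 1 n, complementary A n (n - j) * E j := by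
      rw [Finset.mul_sum]
      refine Finset.sum_le_sum fun j hj => ?_
      have hj' := mem_Ico.1 hj
      have hp := hPn j (Ico_subset_Icc_self hj)
      have e1 := ih' j hj'.2
      have e2 := ih' (j - 1) (by omega)
      have e3 := hEmono (j - 1) j (by omega) (by omega)
      have e4 : offset θ V j ≤ 2 * E j * G := by
        have : V (j - 1) ≤ 2 * E j * G := by nlinarith
        unfold offset; nlinarith
      calc _ ≤ complementary A n (n - j) * (L * (2 * E j * G)) := by gcongr
        _ = _ := by ring
    have h4 : complementary A n 0 * (L * offset θ V n) ≤ 1 / 4 * V n := by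
      have e1 : offset θ V n ≤ V n := by unfold offset; nlinarith
      have e2 := hA.complementary_nonneg hn hn1
      calc _ ≤ complementary A n 0 * (L * V n) := by gcongr
        _ = L * complementary A n 0 * V n := by ring
        _ ≤ _ := by gcongr; exacts [hV n, hP n hn1 hn]
    have h5 := hGn n hn1 le_rfl
    have h6 := mul_le_mul_of_nonneg_left (hE n hn1 hn) hG0
    -- Altogether `3/4 V n ≤ G + G (E n - 1) / 2`, which is stronger than needed because `1 ≤ E n`.
    nlinarith [mul_nonneg hG0 (sub_nonneg.2 (hE1 n hn))]

end IsMonotoneKernel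

/-! ### The energy inequality for the offset average -/

/-- The surplus `S² / (2c)` makes the induction work: adding one increment completes the square `(S
+ w d)² / (2w)`, and a larger `c` only weakens the bound. -/
theorem sum_weighted_diff_sq_le {w v : ℕ → ℝ} (hw : ∀ k, 0 < w k) (hmono : ∀ k, w k ≤ w (k + 1))
    (m : ℕ) : ∀ c : ℝ, 0 < c → (∀ k < m, w k ≤ c) →
    (∑ k ∈ range m, w k * (v (k + 1) - v k)) ^ 2 / (2 * c) ≤
      (∑ k ∈ range m, w k * (v (k + 1) - v k)) * v m
        - 1 / 2 * ∑ k ∈ range m, w k * (v (k + 1) ^ 2 - v k ^ 2) := by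
  induction m with
  | zero => intro c _ _; simp
  | succ m ih =>
    intro c hc h
    have h0 := ih (w m) (hw m) fun k hk => monotone_nat_of_le_succ hmono hk.le
    rw [Finset.sum_range_succ, Finset.sum_range_succ]
    set S := ∑ k ∈ range m, w k * (v (k + 1) - v k)
    set Q := ∑ k ∈ range m, w k * (v (k + 1) ^ 2 - v k ^ 2)
    have hwm := hw m
    have h1 : (S + w m * (v (m + 1) - v m)) ^ 2 / (2 * c)
        ≤ (S + w m * (v (m + 1) - v m)) ^ 2 / (2 * w m) := by
      gcongr
      exact h m (by omega)
    have h2 : (S + w m * (v (m + 1) - v m)) ^ 2 / (2 * w m)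
        = S ^ 2 / (2 * w m) + S * (v (m + 1) - v m) + w m * (v (m + 1) - v m) ^ 2 / 2 := by
      field_simp; ring
    rw [h2] at h1
    refine h1.trans ?_
    linear_combination h0

theorem sum_weighted_diff_mul_offset {w v : ℕ → ℝ} (hw : ∀ k, 0 < w k)
    (hmono : ∀ k, w k ≤ w (k + 1)) {θ : ℝ} (hθ : 0 ≤ θ) (hθ' : θ < 1 / 2) (m : ℕ)
    (hlast : ∀ k < m, (1 - θ) * w k ≤ (1 - 2 * θ) * w m) :
    1 / 2 * ∑ k ∈ range (m + 1), w k * (v (k + 1) ^ 2 - v k ^ 2) ≤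
      (∑ k ∈ range (m + 1), w k * (v (k + 1) - v k)) * offset θ v (m + 1) := by
  have h1 : 0 < 1 - θ := by linarith
  have h2 : 0 < 1 - 2 * θ := by linarith
  have hwm := hw m
  -- The hypothesis `hlast` permits a constant smaller than `w m`; the larger surplus pays for
  -- testing with the offset average instead of `v (m + 1)`.
  have h0 := sum_weighted_diff_sq_le hw hmono (v := v) m ((1 - 2 * θ) * w m / (1 - θ))
    (by positivity) fun k hk => by rw [le_div_iff₀ h1]; linarith [hlast k hk]
  rw [Finset.sum_range_succ, Finset.sum_range_succ]
  set S := ∑ k ∈ range m, w k * (v (k + 1) - v k)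
  set Q := ∑ k ∈ range m, w k * (v (k + 1) ^ 2 - v k ^ 2)
  simp only [offset, Nat.add_sub_cancel]
  set d := v (m + 1) - v m with hd
  have hv : v (m + 1) = v m + d := by rw [hd]; ring
  -- As a quadratic form in `(S, d)` this has discriminant `-θ(1 - θ) ≤ 0`.
  have key : 0 ≤ S ^ 2 / (2 * ((1 - 2 * θ) * w m / (1 - θ))) + (1 - θ) * S * d
      + (1 / 2 - θ) * w m * d ^ 2 := by
    have : S ^ 2 / (2 * ((1 - 2 * θ) * w m / (1 - θ))) + (1 - θ) * S * d
      + (1 / 2 - θ) * w m * d ^ 2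
      = ((1 - θ) * (S + (1 - 2 * θ) * w m * d) ^ 2 + θ * ((1 - 2 * θ) * w m * d) ^ 2)
        / (2 * (1 - 2 * θ) * w m) := by
      field_simp; ring
    rw [this]; positivity
  rw [hv]
  linear_combination h0 + key

theorem sum_Icc_one_eq_sum_range (f : ℕ → ℝ) (n : ℕ) :
    ∑ k ∈ Icc 1 n, f k = ∑ k ∈ range n, f (k + 1) := by
  induction n with
  | zero => simp
  | succ n ih => rw [Finset.sum_Icc_succ_top (by omega), ih, Finset.sum_range_succ]

theorem IsMonotoneKernel.energy {A : ℕ → ℕ → ℝ} {N n : ℕ} (hA : IsMonotoneKernel A N) (hn1 : 1 ≤ n)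
    (hn : n ≤ N) {θ : ℝ} (hθ : 0 ≤ θ) (hθ' : θ < 1 / 2)
    (hlast : 2 ≤ n → (1 - θ) * A n 1 ≤ (1 - 2 * θ) * A n 0) (v : ℕ → ℝ) :
    1 / 2 * ∑ k ∈ Icc 1 n, A n (n - k) * (v k ^ 2 - v (k - 1) ^ 2) ≤
      (∑ k ∈ Icc 1 n, A n (n - k) * (v k - v (k - 1))) * offset θ v n := by
  obtain ⟨m, rfl⟩ : ∃ m, n = m + 1 := ⟨n - 1, by omega⟩
  rw [sum_Icc_one_eq_sum_range, sum_Icc_one_eq_sum_range]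
  have hmono : ∀ k, A (m + 1) (m - k) ≤ A (m + 1) (m - (k + 1)) := fun k => by
    rcases Nat.lt_or_ge k m with hk | hk
    · have := hA.anti (m + 1) hn (m - (k + 1)) (by omega)
      rwa [show m - (k + 1) + 1 = m - k by omega] at this
    -- Truncated subtraction keeps the weights constant beyond `k = m`, so positivity and
    -- monotonicity hold for all indices.
    · rw [show m - (k + 1) = m - k by omega]
  have := sum_weighted_diff_mul_offset (w := fun k => A (m + 1) (m - k)) (v := v)
    (fun k => hA.pos _ hn _ (by omega)) hmono hθ hθ' m (fun k hk => by
      refine le_trans ?_ ((hlast (by omega)).trans_eq (by simp))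
      refine mul_le_mul_of_nonneg_left ?_ (by linarith)
      have := monotone_nat_of_le_succ hmono (show k ≤ m - 1 by omega)
      simpa [show m - (m - 1) = 1 by omega] using this)
  simpa only [Nat.add_sub_add_right, Nat.add_sub_cancel] using this

end FracCN

namespace FracCN

open Set intervalIntegral

/-! ### Integrals against the centred linear weight -/

section Centred

variable {g : ℝ → ℝ} {p q : ℝ}

theorem integral_centred (p q : ℝ) : ∫ s in p..q, (s - (p + q) / 2) = 0 := by
  rw [intervalIntegral.integral_sub (by simp) (by simp), integral_id, intervalIntegral.integral_const,
    smul_eq_mul]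
  ring

theorem integral_centred_sq (p q : ℝ) : ∫ s in p..q, (s - (p + q) / 2) ^ 2 = (q - p) ^ 3 / 12 := by
  rw [intervalIntegral.integral_comp_sub_right (fun s => s ^ 2), integral_pow]
  norm_num; ring

/-- The weight has mean zero. Subtracting a value of `g` at the midpoint or at an endpoint is the
device behind the sign, endpoint and slope estimates below. -/
theorem integral_centred_mul_sub_const (hg : ContinuousOn g (Icc p q)) (hpq : p ≤ q) (a : ℝ) :
    ∫ s in p..q, (s - (p + q) / 2) * (g s - a) = ∫ s in p..q, (s - (p + q) / 2) * g s := by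
  have hi : IntervalIntegrable (fun s => (s - (p + q) / 2) * g s) MeasureTheory.volume p q :=
    ContinuousOn.intervalIntegrable (by rw [uIcc_of_le hpq]; fun_prop)
  simp_rw [mul_sub]
  rw [intervalIntegral.integral_sub hi (Continuous.intervalIntegrable (by fun_prop) _ _),
    intervalIntegral.integral_mul_const, integral_centred]
  ring

theorem integral_centred_mul_nonneg (hg : ContinuousOn g (Icc p q)) (hpq : p ≤ q)
    (hmono : MonotoneOn g (Icc p q)) : 0 ≤ ∫ s in p..q, (s - (p + q) / 2) * g s := by
  rw [← integral_centred_mul_sub_const hg hpq (g ((p + q) / 2))]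
  have hm : (p + q) / 2 ∈ Icc p q := ⟨by linarith, by linarith⟩
  refine intervalIntegral.integral_nonneg hpq fun s hs => ?_
  rcases le_total s ((p + q) / 2) with h | h
  · exact mul_nonneg_of_nonpos_of_nonpos (by linarith) (by linarith [hmono hs hm h])
  · exact mul_nonneg (by linarith) (by linarith [hmono hm hs h])

theorem integral_centred_mul_le (hg : ContinuousOn g (Icc p q)) (hpq : p ≤ q)
    (h0 : ∀ s ∈ Icc p q, 0 ≤ g s) :
    ∫ s in p..q, (s - (p + q) / 2) * g s ≤ (q - p) / 2 * ∫ s in p..q, g s := by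
  rw [← intervalIntegral.integral_const_mul]
  refine intervalIntegral.integral_mono_on hpq
    (ContinuousOn.intervalIntegrable (by rw [uIcc_of_le hpq]; fun_prop))
    (ContinuousOn.intervalIntegrable (by rw [uIcc_of_le hpq]; fun_prop)) fun s hs => ?_
  exact mul_le_mul_of_nonneg_right (by linarith [hs.2]) (h0 s hs)

theorem integral_centred_mul_le_sub (hg : ContinuousOn g (Icc p q)) (hpq : p ≤ q)
    (hmono : MonotoneOn g (Icc p q)) :
    ∫ s in p..q, (s - (p + q) / 2) * g s ≤ (q - p) / 2 * ((∫ s in p..q, g s) - (q - p) * g p) := by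
  have hi : IntervalIntegrable g MeasureTheory.volume p q :=
    ContinuousOn.intervalIntegrable (by rwa [uIcc_of_le hpq])
  have h := integral_centred_mul_le (g := fun s => g s - g p) (by fun_prop) hpq fun s hs =>
    sub_nonneg.2 (hmono (left_mem_Icc.2 hpq) hs hs.1)
  rwa [integral_centred_mul_sub_const hg hpq, intervalIntegral.integral_sub hi (by simp),
    intervalIntegral.integral_const, smul_eq_mul] at h

theorem integral_centred_mul_le_of_slope (hg : ContinuousOn g (Icc p q)) (hpq : p ≤ q) {D : ℝ}
    (hD : ∀ x ∈ Icc p q, ∀ y ∈ Icc p q, y ≤ x → g x - g y ≤ D * (x - y)) :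
    ∫ s in p..q, (s - (p + q) / 2) * g s ≤ D * ((q - p) ^ 3 / 12) := by
  rw [← integral_centred_mul_sub_const hg hpq (g ((p + q) / 2)), ← integral_centred_sq,
    ← intervalIntegral.integral_const_mul]
  have hm : (p + q) / 2 ∈ Icc p q := ⟨by linarith, by linarith⟩
  refine intervalIntegral.integral_mono_on hpq
    (ContinuousOn.intervalIntegrable (by rw [uIcc_of_le hpq]; fun_prop))
    (Continuous.intervalIntegrable (by fun_prop) _ _) fun s hs => ?_
  rcases le_total s ((p + q) / 2) with h | h
  · nlinarith [hD _ hm _ hs h]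
  · nlinarith [hD _ hs _ hm h]

theorem integral_le_of_slope (hg : ContinuousOn g (Icc p q)) (hpq : p ≤ q) {D : ℝ}
    (hD : ∀ y ∈ Icc p q, D * (q - y) ≤ g q - g y) :
    ∫ s in p..q, g s ≤ (q - p) * g q - D * (q - p) ^ 2 / 2 := by
  have h : ∫ s in p..q, g s ≤ ∫ s in p..q, (g q - D * (q - s)) :=
    intervalIntegral.integral_mono_on hpq
    (ContinuousOn.intervalIntegrable (by rwa [uIcc_of_le hpq]))
    (Continuous.intervalIntegrable (by fun_prop) _ _) fun s hs => by linarith [hD s hs]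
  refine h.trans_eq ?_
  rw [intervalIntegral.integral_sub (by simp) (Continuous.intervalIntegrable (by fun_prop) _ _),
    intervalIntegral.integral_const_mul, intervalIntegral.integral_comp_sub_left (fun s => s),
    integral_id, intervalIntegral.integral_const, smul_eq_mul]
  ring

end Centred

/-! ### The Riemann–Liouville kernel -/

theorem omega_nonneg {β x : ℝ} (hβ : 0 < β) (hx : 0 ≤ x) : 0 ≤ omega β x :=
  div_nonneg (Real.rpow_nonneg hx _) (Real.Gamma_pos_of_pos hβ).le

theorem omega_pos {β x : ℝ} (hβ : 0 < β) (hx : 0 < x) : 0 < omega β x :=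
  div_pos (Real.rpow_pos_of_pos hx _) (Real.Gamma_pos_of_pos hβ)

/-- Zero must be excluded: for `β < 1` the convention `0 ^ (β - 1) = 0` gives `omega β 0 = 0`.
Comparisons on cells touching the singularity are therefore made on open intervals. -/
theorem omega_anti {β x y : ℝ} (hβ : 0 < β) (hβ' : β ≤ 1) (hx : 0 < x) (hxy : x ≤ y) :
    omega β y ≤ omega β x :=
  div_le_div_of_nonneg_right (Real.rpow_le_rpow_of_nonpos hx hxy (by linarith))
    (Real.Gamma_pos_of_pos hβ).le

theorem omega_mono {β x y : ℝ} (hβ : 1 ≤ β) (hx : 0 ≤ x) (hxy : x ≤ y) :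
    omega β x ≤ omega β y :=
  div_le_div_of_nonneg_right (Real.rpow_le_rpow hx hxy (by linarith))
    (Real.Gamma_pos_of_pos (by linarith)).le

theorem continuousOn_omega (β : ℝ) : ContinuousOn (omega β) (Ioi 0) :=
  (continuousOn_id.rpow_const fun _ hx => Or.inl (ne_of_gt hx)).div_const _

theorem intervalIntegrable_omega {β : ℝ} (hβ : 0 < β) (p q : ℝ) :
    IntervalIntegrable (omega β) MeasureTheory.volume p q :=
  (intervalIntegrable_rpow' (by linarith)).div_const _

theorem integral_omega {β : ℝ} (hβ : 0 < β) (p q : ℝ) :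
    ∫ s in p..q, omega β s = omega (β + 1) q - omega (β + 1) p := by
  unfold omega
  rw [intervalIntegral.integral_div, integral_rpow (Or.inl (by linarith)), Real.Gamma_add_one hβ.ne',
    sub_add_cancel, add_sub_cancel_right]
  field_simp

theorem omega_add_one_zero {β : ℝ} (hβ : 0 < β) : omega (β + 1) 0 = 0 := by
  rw [omega, add_sub_cancel_right, Real.zero_rpow hβ.ne', zero_div]

theorem hasDerivAt_omega {β x : ℝ} (hβ : 0 < β) (hx : 0 < x) :
    HasDerivAt (omega (β + 1)) (omega β x) x := by
  have h := (Real.hasDerivAt_rpow_const (x := x) (p := β) (Or.inl hx.ne')).div_const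
    (Real.Gamma (β + 1))
  unfold omega
  rw [add_sub_cancel_right]
  refine h.congr_deriv ?_
  rw [Real.Gamma_add_one hβ.ne', mul_div_mul_left _ _ hβ.ne']

/-- The slope `-ω_{1-α}'` of the weakly singular kernel. -/
noncomputable def omegaSlope (α x : ℝ) : ℝ := α * x ^ (-α - 1) / Real.Gamma (1 - α)

theorem omegaSlope_nonneg {α x : ℝ} (hα : 0 < α) (hα' : α < 1) (hx : 0 < x) :
    0 ≤ omegaSlope α x := by
  have := Real.Gamma_pos_of_pos (sub_pos.2 hα')
  unfold omegaSlope; positivity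

theorem omegaSlope_anti {α x y : ℝ} (hα : 0 < α) (hα' : α < 1) (hx : 0 < x) (hxy : x ≤ y) :
    omegaSlope α y ≤ omegaSlope α x := by
  have := Real.Gamma_pos_of_pos (sub_pos.2 hα')
  have := Real.rpow_le_rpow_of_nonpos hx hxy (show -α - 1 ≤ 0 by linarith)
  unfold omegaSlope
  gcongr

/-- Convexity of the kernel, reduced by scaling to `z^(-α) = exp (-α log z) ≥ 1 - α log z ≥ 1 - α (z
- 1)`. -/
theorem omega_tangent {α x y : ℝ} (hα : 0 < α) (hα' : α < 1) (hx : 0 < x) (hy : 0 < y) :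
    omega (1 - α) y - omegaSlope α y * (x - y) ≤ omega (1 - α) x := by
  have hG := Real.Gamma_pos_of_pos (sub_pos.2 hα')
  have hz : 0 < x / y := by positivity
  have h1 : 1 - α * (x / y - 1) ≤ (x / y) ^ (-α) := by
    rw [Real.rpow_def_of_pos hz]
    nlinarith [Real.add_one_le_exp (Real.log (x / y) * -α), Real.log_le_sub_one_of_pos hz]
  have h2 : x ^ (-α) = y ^ (-α) * (x / y) ^ (-α) := by
    rw [← Real.mul_rpow hy.le hz.le, mul_div_cancel₀ _ hy.ne']
  have hy' := Real.rpow_pos_of_pos hy (-α)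
  unfold omega omegaSlope
  rw [show 1 - α - 1 = -α by ring, h2, Real.rpow_sub_one hy.ne']
  have h3 : y ^ (-α) / Real.Gamma (1 - α) - α * (y ^ (-α) / y) / Real.Gamma (1 - α) * (x - y)
      = y ^ (-α) * (1 - α * (x / y - 1)) / Real.Gamma (1 - α) := by field_simp
  rw [h3]
  gcongr

theorem integral_omega_sub {β : ℝ} (hβ : 0 < β) (c p q : ℝ) :
    ∫ s in p..q, omega β (c - s) = omega (β + 1) (c - p) - omega (β + 1) (c - q) := by
  rw [intervalIntegral.integral_comp_sub_left (omega β), integral_omega hβ]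

theorem intervalIntegrable_omega_sub {β : ℝ} (hβ : 0 < β) (c p q : ℝ) :
    IntervalIntegrable (fun s => omega β (c - s)) MeasureTheory.volume p q := by
  have := (intervalIntegrable_omega hβ (c - p) (c - q)).comp_sub_left c
  simpa using this

theorem continuousOn_omega_sub (β : ℝ) {c p q : ℝ} (hq : q < c) :
    ContinuousOn (fun s => omega β (c - s)) (Icc p q) :=
  (continuousOn_omega β).comp (by fun_prop) fun s hs => show 0 < c - s by linarith [hs.2]

theorem monotoneOn_omega_sub {β c p q : ℝ} (hβ : 0 < β) (hβ' : β ≤ 1) (hq : q < c) :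
    MonotoneOn (fun s => omega β (c - s)) (Icc p q) := fun _ _ y hy hxy =>
  omega_anti hβ hβ' (by linarith [hy.2]) (by linarith)

end FracCN

namespace FracCN

open Set intervalIntegral

theorem mul_omega_add_one {β x : ℝ} (hβ : 0 < β) (hx : 0 < x) :
    β * omega (β + 1) x = x * omega β x := by
  unfold omega
  rw [Real.Gamma_add_one hβ.ne', add_sub_cancel_right, Real.rpow_sub_one hx.ne']
  field_simp

/-! ### Time meshes -/

namespace IsTimeMesh

variable {t : ℕ → ℝ} {N : ℕ} {T : ℝ}

theorem step_pos (ht : IsTimeMesh t N T) {k : ℕ} (hk : 1 ≤ k) (hkN : k ≤ N) : 0 < step t k := by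
  have := ht.lt_succ (k - 1) (by omega)
  rw [Nat.sub_add_cancel hk] at this
  exact sub_pos.2 this

theorem mono (ht : IsTimeMesh t N T) {i j : ℕ} (hij : i ≤ j) (hj : j ≤ N) : t i ≤ t j := by
  induction j, hij using Nat.le_induction with
  | base => exact le_rfl
  | succ j hij ih => exact (ih (by omega)).trans (ht.lt_succ j (by omega)).le

theorem nonneg (ht : IsTimeMesh t N T) {j : ℕ} (hj : j ≤ N) : 0 ≤ t j := by
  simpa [ht.zero] using ht.mono (Nat.zero_le j) hj

theorem pos (ht : IsTimeMesh t N T) {j : ℕ} (hj1 : 1 ≤ j) (hj : j ≤ N) : 0 < t j := by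
  have h1 := ht.lt_succ 0 (by omega)
  rw [ht.zero] at h1
  exact h1.trans_le (ht.mono hj1 hj)

end IsTimeMesh

theorem offset_sub (ν : ℝ) (t : ℕ → ℝ) (n : ℕ) :
    offset ν t n - t (n - 1) = (1 - ν) * step t n := by
  unfold offset step; ring

theorem sub_offset (ν : ℝ) (t : ℕ → ℝ) (n : ℕ) : t n - offset ν t n = ν * step t n := by
  unfold offset step; ring

/-! ### The Alikhanov kernel -/

section Alikhanov

variable {α : ℝ} {t : ℕ → ℝ} {N n k : ℕ} {T : ℝ}

theorem aCoef_eq (hk : 1 ≤ k) (hkn : k < n) : aCoef α t n (n - k) =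
    (∫ s in (t (k - 1))..(t k), omega (1 - α) (offset (α / 2) t n - s)) / step t k := by
  rw [aCoef, if_neg (by omega), intervalIntegral.integral_div, show n - (n - k) = k by omega]

theorem bCoef_eq (hk : 1 ≤ k) (hkn : k < n) : bCoef α t n (n - k) =
    2 / (step t k * (step t k + step t (k + 1))) * ∫ s in (t (k - 1))..(t k),
      (s - (t (k - 1) + t k) / 2) * omega (1 - α) (offset (α / 2) t n - s) := by
  rw [bCoef, show n - (n - k) = k by omega]

theorem aCoef_zero_eq (hα' : α < 1) : aCoef α t n 0 =
    omega (1 - α + 1) ((1 - α / 2) * step t n) / step t n := by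
  rw [aCoef, if_pos rfl, intervalIntegral.integral_div, integral_omega_sub (by linarith), sub_self,
    omega_add_one_zero (by linarith), sub_zero, offset_sub]

theorem lt_offset (hα' : α < 1) (ht : IsTimeMesh t N T) (hkn : k < n) (hn : n ≤ N) : t k < offset (α / 2) t n := by
  have h1 := offset_sub (α / 2) t n
  have h2 := ht.step_pos (show 1 ≤ n by omega) hn
  have h3 := ht.mono (show k ≤ n - 1 by omega) (by omega)
  nlinarith

/-- The centred weight is at most `τ_k / 2`, so `b ≤ τ_k / (τ_k + τ_{k+1}) · a`, and `τ_{k+1} ≥ 4/7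
τ_k` makes the fraction at most `7/11`. -/
theorem bCoef_le_aCoef (hα' : α < 1) (ht : IsTimeMesh t N T) (hρ : StepRatioBound t N)
    (hk : 1 ≤ k) (hkn : k < n) (hn : n ≤ N) :
    bCoef α t n (n - k) ≤ 7 / 11 * aCoef α t n (n - k) := by
  have h1 := ht.step_pos hk (by omega)
  have h2 := ht.step_pos (show 1 ≤ k + 1 by omega) (by omega)
  have hr := hρ k hk (by omega)
  rw [ratio, div_le_iff₀ h2] at hr
  have hc := lt_offset hα' ht hkn hn
  have hg : ∀ s ∈ Icc (t (k - 1)) (t k), 0 ≤ omega (1 - α) (offset (α / 2) t n - s) :=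
    fun s hs => omega_nonneg (by linarith) (by linarith [hs.2])
  have hm := ht.mono (show k - 1 ≤ k by omega) (by omega)
  have h3 := integral_centred_mul_le (continuousOn_omega_sub (1 - α) hc) hm hg
  have h4 := intervalIntegral.integral_nonneg (μ := MeasureTheory.volume) hm hg
  rw [bCoef_eq hk hkn, aCoef_eq hk hkn]
  set I := ∫ s in (t (k - 1))..(t k), omega (1 - α) (offset (α / 2) t n - s)
  rw [show t k - t (k - 1) = step t k from rfl] at h3
  calc _ ≤ 2 / (step t k * (step t k + step t (k + 1))) * (step t k / 2 * I) := by gcongr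
    _ = I / (step t k + step t (k + 1)) := by field_simp
    _ ≤ I / (11 / 7 * step t k) := by gcongr; linarith
    _ = _ := by field_simp

/-! ### Comparison of the Alikhanov kernels with point values and cell averages of `ω_{1-α}`. -/

variable (hα : 0 < α) (hα' : α < 1) (ht : IsTimeMesh t N T)

include hα hα' ht

/-- With `θ = α / 2` the two factors are `1 - 2θ` and `1 - θ`, exactly those in the hypothesis of
the energy inequality. -/
theorem mul_aCoef_zero (hn1 : 1 ≤ n) (hn : n ≤ N) : (1 - α) * aCoef α t n 0 =
    (1 - α / 2) * omega (1 - α) (offset (α / 2) t n - t (n - 1)) := by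
  have h2 := ht.step_pos hn1 hn
  rw [aCoef_zero_eq hα', offset_sub, ← mul_div_assoc,
    mul_omega_add_one (by linarith) (mul_pos (by linarith) h2)]
  field_simp

theorem bCoef_nonneg (hk : 1 ≤ k) (hkn : k < n) (hn : n ≤ N) : 0 ≤ bCoef α t n (n - k) := by
  have h1 := ht.step_pos hk (by omega)
  have h2 := ht.step_pos (show 1 ≤ k + 1 by omega) (by omega)
  have hc := lt_offset hα' ht hkn hn
  rw [bCoef_eq hk hkn]
  refine mul_nonneg (by positivity) (integral_centred_mul_nonneg (continuousOn_omega_sub _ hc)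
    (ht.mono (by omega) (by omega)) (monotoneOn_omega_sub (by linarith) (by linarith) hc))

theorem omega_le_aCoef_sub_bCoef (hk : 1 ≤ k) (hkn : k < n) (hn : n ≤ N) :
    omega (1 - α) (offset (α / 2) t n - t (k - 1)) ≤
      aCoef α t n (n - k) - bCoef α t n (n - k) := by
  have h1 := ht.step_pos hk (by omega)
  have h2 := ht.step_pos (show 1 ≤ k + 1 by omega) (by omega)
  have hc := lt_offset hα' ht hkn hn
  have hm := ht.mono (show k - 1 ≤ k by omega) (by omega)
  have hmono := monotoneOn_omega_sub (p := t (k - 1)) (show 0 < 1 - α by linarith) (by linarith) hc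
  have h3 := integral_centred_mul_le_sub (continuousOn_omega_sub (1 - α) hc) hm hmono
  have h4 := integral_centred_mul_nonneg (continuousOn_omega_sub (1 - α) hc) hm hmono
  rw [bCoef_eq hk hkn, aCoef_eq hk hkn]
  set I := ∫ s in (t (k - 1))..(t k), omega (1 - α) (offset (α / 2) t n - s)
  set J := ∫ s in (t (k - 1))..(t k),
    (s - (t (k - 1) + t k) / 2) * omega (1 - α) (offset (α / 2) t n - s)
  rw [show t k - t (k - 1) = step t k from rfl] at h3
  have h5 : 2 / (step t k * (step t k + step t (k + 1))) * J ≤ 2 / (step t k * step t k) * J := by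
    gcongr; linarith
  have h6 : 2 / (step t k * step t k) * J ≤ 2 / (step t k * step t k) *
      (step t k / 2 * (I - step t k * omega (1 - α) (offset (α / 2) t n - t (k - 1)))) := by
    gcongr
  have h7 : 2 / (step t k * step t k) *
      (step t k / 2 * (I - step t k * omega (1 - α) (offset (α / 2) t n - t (k - 1))))
      = I / step t k - omega (1 - α) (offset (α / 2) t n - t (k - 1)) := by field_simp
  linarith

theorem aCoef_le_omega (hk : 1 ≤ k) (hkn : k < n) (hn : n ≤ N) :
    aCoef α t n (n - k) ≤ omega (1 - α) (offset (α / 2) t n - t k)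
      - omegaSlope α (offset (α / 2) t n - t (k - 1)) * step t k / 2 := by
  have h1 := ht.step_pos hk (by omega)
  have hc := lt_offset hα' ht hkn hn
  have hm := ht.mono (show k - 1 ≤ k by omega) (by omega)
  have h3 := integral_le_of_slope (continuousOn_omega_sub (1 - α) hc) hm
    (D := omegaSlope α (offset (α / 2) t n - t (k - 1))) fun y hy => by
      have e1 := omega_tangent hα hα' (x := offset (α / 2) t n - t k)
        (y := offset (α / 2) t n - y) (by linarith) (by linarith [hy.2])
      have e2 := omegaSlope_anti hα hα' (x := offset (α / 2) t n - y)
        (y := offset (α / 2) t n - t (k - 1)) (by linarith [hy.2]) (by linarith [hy.1])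
      nlinarith [hy.2]
  rw [aCoef_eq hk hkn, div_le_iff₀ h1]
  rw [show t k - t (k - 1) = step t k from rfl] at h3
  linear_combination h3

/-- By convexity, the slope at `t k` is the steepest on cell `k` and the flattest on cell `k + 1`.
This bound is thus exactly the gain that `aCoef_le_omega` provides on cell `k + 1`, and the two
cancel in `kernelA_le_omega`. -/
theorem ratio_mul_bCoef_le (hρ : StepRatioBound t N) (hk : 1 ≤ k) (hkn : k < n) (hn : n ≤ N) :
    ratio t k * bCoef α t n (n - k) ≤
      omegaSlope α (offset (α / 2) t n - t k) * step t (k + 1) / 2 := by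
  have h1 := ht.step_pos hk (by omega)
  have h2 := ht.step_pos (show 1 ≤ k + 1 by omega) (by omega)
  have hr := hρ k hk (by omega)
  rw [ratio, div_le_iff₀ h2] at hr
  have hc := lt_offset hα' ht hkn hn
  have hm := ht.mono (show k - 1 ≤ k by omega) (by omega)
  have hD := omegaSlope_nonneg hα hα' (x := offset (α / 2) t n - t k) (by linarith)
  have h3 := integral_centred_mul_le_of_slope (continuousOn_omega_sub (1 - α) hc) hm
    (D := omegaSlope α (offset (α / 2) t n - t k)) fun x hx y hy hyx => by
      have e1 := omega_tangent hα hα' (x := offset (α / 2) t n - y)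
        (y := offset (α / 2) t n - x) (by linarith [hy.2]) (by linarith [hx.2])
      have e2 := omegaSlope_anti hα hα' (x := offset (α / 2) t n - t k)
        (y := offset (α / 2) t n - x) (by linarith) (by linarith [hx.2])
      nlinarith
  rw [bCoef_eq hk hkn, ratio]
  rw [show t k - t (k - 1) = step t k from rfl] at h3
  set D := omegaSlope α (offset (α / 2) t n - t k)
  set a := step t k
  set b := step t (k + 1)
  calc _ ≤ a / b * (2 / (a * (a + b)) * (D * (a ^ 3 / 12))) := by gcongr
    _ = D * (a ^ 3 / (6 * (b * (a + b)))) := by field_simp; ring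
    -- For `ρ = a / b` this is `ρ³ ≤ 3 (1 + ρ)`, which holds for `ρ ≤ 7/4`.
    _ ≤ D * (b / 2) := by
      refine mul_le_mul_of_nonneg_left ?_ hD
      rw [div_le_iff₀ (by positivity)]
      have e1 : a * a ≤ 49 / 16 * (b * b) := by nlinarith
      have e2 : a * (a * a) ≤ a * (49 / 16 * (b * b)) := by gcongr
      have e3 : a * (b * b) ≤ 7 / 4 * b * (b * b) := by gcongr
      have e4 : 0 < b * (b * b) := by positivity
      linarith
    _ = _ := by ring

theorem kernelA_le_omega (hρ : StepRatioBound t N) (hk : 1 ≤ k) (hkn : k < n) (hn : n ≤ N) :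
    kernelA α t n (n - k) ≤ omega (1 - α) (offset (α / 2) t n - t k) := by
  have h1 := ht.step_pos hk (by omega)
  have h2 := aCoef_le_omega hα hα' ht hk hkn hn
  have h3 := bCoef_nonneg hα hα' ht hk hkn hn
  have hc := lt_offset hα' ht (show k - 1 < n by omega) hn
  have hD := omegaSlope_nonneg hα hα' (x := offset (α / 2) t n - t (k - 1)) (by linarith)
  rw [kernelA, if_neg (by omega), if_neg (by omega)]
  split_ifs with h
  · rw [← h]
    nlinarith
  · have h4 := ratio_mul_bCoef_le hα hα' ht hρ (show 1 ≤ k - 1 by omega) (by omega) hn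
    rw [show n - (k - 1) = n - k + 1 by omega, Nat.sub_add_cancel hk] at h4
    rw [show n - (n - k) - 1 = k - 1 by omega]
    linarith

theorem le_kernelA (hk : 1 ≤ k) (hkn : k < n) (hn : n ≤ N) :
    aCoef α t n (n - k) - bCoef α t n (n - k) ≤ kernelA α t n (n - k) := by
  rw [kernelA, if_neg (by omega), if_neg (by omega)]
  split_ifs with h
  · rw [← h]
  · have h3 := bCoef_nonneg hα hα' ht (show 1 ≤ k - 1 by omega) (show k - 1 < n by omega) hn
    rw [show n - (k - 1) = n - k + 1 by omega] at h3
    rw [show n - (n - k) - 1 = k - 1 by omega]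
    have := mul_nonneg (div_nonneg (ht.step_pos (show 1 ≤ k - 1 by omega) (by omega)).le
      (ht.step_pos (show 1 ≤ k - 1 + 1 by omega) (by omega)).le) h3
    rw [ratio]
    linarith

theorem aCoef_zero_le_kernelA (hn1 : 1 ≤ n) (hn : n ≤ N) :
    aCoef α t n 0 ≤ kernelA α t n 0 := by
  rw [kernelA]
  by_cases h : n = 1
  · rw [if_pos h, h]
  · have h3 := bCoef_nonneg hα hα' ht (show 1 ≤ n - 1 by omega) (show n - 1 < n by omega) hn
    rw [show n - (n - 1) = 1 by omega] at h3
    have := mul_nonneg (div_nonneg (ht.step_pos (show 1 ≤ n - 1 by omega) (by omega)).le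
      (ht.step_pos (show 1 ≤ n - 1 + 1 by omega) (by omega)).le) h3
    rw [if_neg h, if_pos rfl, ratio]
    linarith

theorem omega_le_kernelA_zero (hn1 : 1 ≤ n) (hn : n ≤ N) :
    (1 - α / 2) * omega (1 - α) (offset (α / 2) t n - t (n - 1)) ≤ (1 - α) * kernelA α t n 0 := by
  rw [← mul_aCoef_zero hα hα' ht hn1 hn]
  have := aCoef_zero_le_kernelA hα hα' ht hn1 hn
  nlinarith

theorem kernelA_one_le (hρ : StepRatioBound t N) (hn2 : 2 ≤ n) (hn : n ≤ N) :
    (1 - α / 2) * kernelA α t n 1 ≤ (1 - 2 * (α / 2)) * kernelA α t n 0 := by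
  have h1 := kernelA_le_omega hα hα' ht hρ (show 1 ≤ n - 1 by omega) (by omega) hn
  have h2 := omega_le_kernelA_zero hα hα' ht (by omega) hn
  rw [show n - (n - 1) = 1 by omega] at h1
  nlinarith

theorem kernelA_zero_pos (hn1 : 1 ≤ n) (hn : n ≤ N) : 0 < kernelA α t n 0 := by
  have h2 := omega_le_kernelA_zero hα hα' ht hn1 hn
  have hc := lt_offset hα' ht (show n - 1 < n by omega) hn
  have := mul_pos (show 0 < 1 - α / 2 by linarith)
    (omega_pos (show 0 < 1 - α by linarith) (sub_pos.2 hc))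
  exact pos_of_mul_pos_right (this.trans_le h2) (by linarith)

theorem isMonotoneKernel_kernelA (hρ : StepRatioBound t N) :
    IsMonotoneKernel (kernelA α t) N where
  pos n hn m hm := by
    rcases Nat.eq_zero_or_pos m with rfl | hm0
    · exact kernelA_zero_pos hα hα' ht hm hn
    · obtain ⟨k, hk, rfl⟩ : ∃ k, 1 ≤ k ∧ m = n - k := ⟨n - m, by omega, by omega⟩
      have hc := lt_offset hα' ht (show k - 1 < n by omega) hn
      exact (omega_pos (by linarith) (sub_pos.2 hc)).trans_le
        ((omega_le_aCoef_sub_bCoef hα hα' ht hk (by omega) hn).trans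
        (le_kernelA hα hα' ht hk (by omega) hn))
  anti n hn m hm := by
    rcases Nat.eq_zero_or_pos m with rfl | hm0
    · have h1 := kernelA_one_le hα hα' ht hρ hm hn
      have h2 := kernelA_zero_pos hα hα' ht (show 1 ≤ n by omega) hn
      have : (1 - α / 2) * kernelA α t n 1 ≤ (1 - α / 2) * kernelA α t n 0 := by nlinarith
      exact le_of_mul_le_mul_left this (by linarith)
    · obtain ⟨k, hk, rfl⟩ : ∃ k, 2 ≤ k ∧ m = n - k := ⟨n - m, by omega, by omega⟩
      have h1 := kernelA_le_omega hα hα' ht hρ (show 1 ≤ k - 1 by omega) (by omega) hn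
      rw [show n - (k - 1) = n - k + 1 by omega] at h1
      -- The point value at `t (k - 1)` separates the kernels of the adjacent cells `k - 1` and `k`.
      exact h1.trans ((omega_le_aCoef_sub_bCoef hα hα' ht (by omega) (by omega) hn).trans
        (le_kernelA hα hα' ht (by omega) (by omega) hn))

/-- On earlier cells `A ≥ a - b ≥ 4/11 a`, and moving from `t_{n-θ}` to the later `t_n` only
decreases the kernel. On the last cell the cut-off at `t_{n-θ}` costs at most a factor `2`, since
`(1 - θ)^(1-α) ≥ 1 - θ ≥ 1/2`. -/
theorem integral_omega_le_kernelA (hρ : StepRatioBound t N) (hk : 1 ≤ k) (hkn : k ≤ n)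
    (hn : n ≤ N) : (∫ s in (t (k - 1))..(t k), omega (1 - α) (t n - s)) / step t k ≤
      11 / 4 * kernelA α t n (n - k) := by
  have h1 := ht.step_pos hk (by omega)
  have hm := ht.mono (show k - 1 ≤ k by omega) (by omega)
  have hn0 := ht.step_pos (show 1 ≤ n by omega) hn
  rcases hkn.lt_or_eq with hkn | rfl
  · have hc := lt_offset hα' ht hkn hn
    have h2 := bCoef_le_aCoef hα' ht hρ hk hkn hn
    have h3 := le_kernelA hα hα' ht hk hkn hn
    have h4 : (∫ s in (t (k - 1))..(t k), omega (1 - α) (t n - s)) / step t k ≤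
        aCoef α t n (n - k) := by
      rw [aCoef_eq hk hkn]
      refine div_le_div_of_nonneg_right (intervalIntegral.integral_mono_on hm
        (intervalIntegrable_omega_sub (by linarith) _ _ _)
        (intervalIntegrable_omega_sub (by linarith) _ _ _) fun s hs => ?_) h1.le
      have := sub_offset (α / 2) t n
      exact omega_anti (by linarith) (by linarith) (by linarith [hs.2]) (by nlinarith)
    linarith
  · have h2 := aCoef_zero_le_kernelA hα hα' ht hk hn
    rw [aCoef_zero_eq hα'] at h2
    rw [integral_omega_sub (by linarith), sub_self, omega_add_one_zero (by linarith), sub_zero,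
      Nat.sub_self, show t k - t (k - 1) = step t k from rfl]
    have hG : 0 < Real.Gamma (1 - α + 1) := Real.Gamma_pos_of_pos (by linarith)
    have h3 : omega (1 - α + 1) (step t k) / 2 ≤
        omega (1 - α + 1) ((1 - α / 2) * step t k) := by
      unfold omega
      rw [add_sub_cancel_right, div_right_comm]
      refine div_le_div_of_nonneg_right ?_ hG.le
      rw [Real.mul_rpow (by linarith) h1.le]
      have e1 : (1 : ℝ) / 2 ≤ (1 - α / 2) ^ (1 - α) := by
        have := Real.rpow_le_rpow_of_exponent_ge (show 0 < 1 - α / 2 by linarith) (by linarith)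
          (show 1 - α ≤ 1 by linarith)
        rw [Real.rpow_one] at this
        linarith
      nlinarith [Real.rpow_pos_of_pos h1 (1 - α)]
    have h4 := omega_nonneg (show 0 < 1 - α + 1 by linarith) h1.le
    have h5 : omega (1 - α + 1) (step t k) / 2 / step t k ≤
        omega (1 - α + 1) ((1 - α / 2) * step t k) / step t k := by gcongr
    have h6 : omega (1 - α + 1) (step t k) / 2 / step t k =
      omega (1 - α + 1) (step t k) / step t k / 2 := by ring
    have h7 : 0 ≤ omega (1 - α + 1) (step t k) / step t k := by positivity
    linarith

end Alikhanov

end FracCN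

namespace FracCN

open Set intervalIntegral

/-! ### Convolutions of Riemann–Liouville kernels -/

theorem integral_omega_mul_omega {β γ c : ℝ} (hβ : 0 < β) (hγ : 0 < γ) (hc : 0 < c) :
    ∫ s in (0 : ℝ)..c, omega β (c - s) * omega γ s = omega (β + γ) c := by
  have hGβ := Real.Gamma_pos_of_pos hβ
  have hGγ := Real.Gamma_pos_of_pos hγ
  have hG := Real.Gamma_pos_of_pos (add_pos hγ hβ)
  have h := Complex.betaIntegral_scaled γ β hc
  rw [Complex.betaIntegral_eq_Gamma_mul_div _ _ (by simpa) (by simpa)] at h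
  have h1 : ∫ x in (0 : ℝ)..c, (x : ℂ) ^ ((γ : ℂ) - 1) * ((c : ℂ) - x) ^ ((β : ℂ) - 1)
      = ((∫ x in (0 : ℝ)..c, x ^ (γ - 1) * (c - x) ^ (β - 1) : ℝ) : ℂ) := by
    rw [← intervalIntegral.integral_ofReal]
    refine intervalIntegral.integral_congr fun x hx => ?_
    rw [uIcc_of_le hc.le] at hx
    rw [Complex.ofReal_mul, Complex.ofReal_cpow hx.1, Complex.ofReal_cpow (by linarith [hx.2])]
    push_cast; rfl
  have h2 : (c : ℂ) ^ ((γ : ℂ) + β - 1) = ((c ^ (γ + β - 1) : ℝ) : ℂ) := by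
    rw [Complex.ofReal_cpow hc.le]; push_cast; rfl
  rw [h1, h2, ← Complex.ofReal_add, Complex.Gamma_ofReal, Complex.Gamma_ofReal,
    Complex.Gamma_ofReal] at h
  have h3 : ∫ x in (0 : ℝ)..c, x ^ (γ - 1) * (c - x) ^ (β - 1)
      = c ^ (γ + β - 1) * (Real.Gamma γ * Real.Gamma β / Real.Gamma (γ + β)) := by
    exact_mod_cast h
  have h4 : ∀ s, omega β (c - s) * omega γ s
      = s ^ (γ - 1) * (c - s) ^ (β - 1) / (Real.Gamma γ * Real.Gamma β) := fun s => by
    unfold omega; field_simp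
  simp_rw [h4]
  rw [intervalIntegral.integral_div, h3, omega, add_comm β γ]
  field_simp

theorem intervalIntegrable_omega_mul_omega {β γ c p q : ℝ} (hβ : 0 < β) (hγ : 0 < γ) (hc : 0 < c)
    (hp : 0 ≤ p) (hpq : p ≤ q) (hq : q ≤ c) :
    IntervalIntegrable (fun s => omega β (c - s) * omega γ s) MeasureTheory.volume p q := by
  have h : IntervalIntegrable (fun s => omega β (c - s) * omega γ s) MeasureTheory.volume 0 c := by
    -- A non-integrable function has integral zero by convention, whereas the Beta integral is
    -- positive.
    by_contra hn
    have h0 := intervalIntegral.integral_undef hn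
    rw [integral_omega_mul_omega hβ hγ hc] at h0
    exact (omega_pos (add_pos hβ hγ) hc).ne' h0
  refine h.mono_set ?_
  rw [uIcc_of_le hpq, uIcc_of_le hc.le]
  exact Icc_subset_Icc hp hq

/-- Chebyshev's integral inequality for oppositely ordered functions, the first of which attains
its mean value. -/
theorem integral_mul_le_of_monotone_antitone {g v : ℝ → ℝ} {p q x : ℝ} (hpq : p < q)
    (hx : x ∈ Ioo p q) (hgx : g x * (q - p) = ∫ s in p..q, g s) (hg : MonotoneOn g (Ioo p q))
    (hv : AntitoneOn v (Ioo p q)) (hgi : IntervalIntegrable g MeasureTheory.volume p q)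
    (hvi : IntervalIntegrable v MeasureTheory.volume p q)
    (hgv : IntervalIntegrable (fun s => g s * v s) MeasureTheory.volume p q) :
    ∫ s in p..q, g s * v s ≤ (∫ s in p..q, g s) / (q - p) * ∫ s in p..q, v s := by
  have hc : (∫ s in p..q, g s) / (q - p) = g x := by
    rw [← hgx, mul_div_cancel_right₀ _ (sub_pos.2 hpq).ne']
  -- Pointwise this is `(g s - g x) (v s - v x) ≤ 0`; the bracket integrates to zero because `g x`
  -- is the mean.
  have h : ∫ s in p..q, g s * v s ≤ ∫ s in p..q, (g x * v s + (v x * g s - g x * v x)) := by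
    refine integral_mono_on_of_le_Ioo hpq.le hgv
      ((hvi.const_mul _).add ((hgi.const_mul _).sub (by simp))) fun s hs => ?_
    rcases le_total s x with h | h
    · nlinarith [mul_nonneg (sub_nonneg.2 (hg hs hx h)) (sub_nonneg.2 (hv hs hx h))]
    · nlinarith [mul_nonneg (sub_nonneg.2 (hg hx hs h)) (sub_nonneg.2 (hv hx hs h))]
  refine h.trans_eq ?_
  rw [intervalIntegral.integral_add (hvi.const_mul _) ((hgi.const_mul _).sub (by simp)),
    intervalIntegral.integral_sub (hgi.const_mul _) (by simp), intervalIntegral.integral_const_mul,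
    intervalIntegral.integral_const_mul, intervalIntegral.integral_const, ← hgx, smul_eq_mul,
    mul_div_cancel_right₀ _ (sub_pos.2 hpq).ne']
  ring

theorem exists_omega_sub_eq_average {β c p q : ℝ} (hβ : 0 < β) (hpq : p < q) (hq : q ≤ c) :
    ∃ x ∈ Ioo p q, omega β (c - x) * (q - p) = ∫ s in p..q, omega β (c - s) := by
  have hcont : Continuous (omega (β + 1)) := by
    unfold omega
    rw [add_sub_cancel_right]
    exact (Real.continuous_rpow_const hβ.le).div_const _
  obtain ⟨x, hx, h⟩ := exists_hasDerivAt_eq_slope (fun s => -omega (β + 1) (c - s))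
    (fun s => omega β (c - s)) hpq (by fun_prop) fun s hs => by
      exact (((hasDerivAt_omega hβ (x := c - s) (by linarith [hs.2])).comp s
        ((hasDerivAt_id s).const_sub c)).neg).congr_deriv (by simp)
  refine ⟨x, hx, ?_⟩
  rw [h, div_mul_cancel₀ _ (sub_pos.2 hpq).ne', integral_omega_sub hβ]
  ring

theorem integral_omega_mul_omega_le_of_le_one {β γ c p q : ℝ} (hβ : 0 < β) (hβ' : β ≤ 1)
    (hγ : 0 < γ) (hγ' : γ ≤ 1) (hp : 0 ≤ p) (hpq : p < q) (hq : q ≤ c) :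
    ∫ s in p..q, omega β (c - s) * omega γ s ≤
      (∫ s in p..q, omega β (c - s)) / (q - p) * (omega (γ + 1) q - omega (γ + 1) p) := by
  obtain ⟨x, hx, h⟩ := exists_omega_sub_eq_average hβ hpq hq
  rw [← integral_omega hγ]
  exact integral_mul_le_of_monotone_antitone hpq hx h
    (fun a ha b hb hab => omega_anti hβ hβ' (by linarith [hb.2]) (by linarith))
    (fun a ha b hb hab => omega_anti hγ hγ' (by linarith [ha.1]) hab)
    (intervalIntegrable_omega_sub hβ _ _ _) (intervalIntegrable_omega hγ _ _)
    (intervalIntegrable_omega_mul_omega hβ hγ (by linarith) hp hpq.le hq)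

theorem integral_omega_mul_omega_le_of_one_le {β γ c p q : ℝ} (hβ : 0 < β)
    (hγ : 1 ≤ γ) (hp : 0 ≤ p) (hpq : p < q) (hq : q ≤ c) :
    ∫ s in p..q, omega β (c - s) * omega γ s ≤
      (∫ s in p..q, omega β (c - s)) / (q - p) * ((q - p) * omega γ q) := by
  rw [← mul_assoc, div_mul_cancel₀ _ (sub_pos.2 hpq).ne', ← intervalIntegral.integral_mul_const]
  refine intervalIntegral.integral_mono_on hpq.le
    (intervalIntegrable_omega_mul_omega hβ (by linarith) (by linarith) hp hpq.le hq)
    ((intervalIntegrable_omega_sub hβ _ _ _).mul_const _) fun s hs => ?_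
  exact mul_le_mul_of_nonneg_left (omega_mono hγ (by linarith [hs.1]) hs.2)
    (omega_nonneg hβ (by linarith [hs.2]))

/-! ### The complementary kernel applied to powers -/

section Powers

open Finset

variable {α : ℝ} {t : ℕ → ℝ} {N n : ℕ} {T : ℝ}

/-- The semigroup law is split over the cells. On each cell `ω_{1-α}` is replaced by its average,
hence by `11/4 A`, and `X i` is whatever then bounds the integral of `ω_γ`. -/
theorem omega_conv_le {γ : ℝ} (hα : 0 < α) (hα' : α < 1) (ht : IsTimeMesh t N T)
    (hρ : StepRatioBound t N) (hγ : 0 < γ) {j : ℕ} (hj1 : 1 ≤ j) (hj : j ≤ N) {X : ℕ → ℝ}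
    (hX : ∀ i, 1 ≤ i → i ≤ j → 0 ≤ X i ∧
      ∫ s in (t (i - 1))..(t i), omega (1 - α) (t j - s) * omega γ s ≤
        (∫ s in (t (i - 1))..(t i), omega (1 - α) (t j - s)) / step t i * X i) :
    omega (1 - α + γ) (t j) ≤ 11 / 4 * ∑ i ∈ Icc 1 j, kernelA α t j (j - i) * X i := by
  have hsplit := intervalIntegral.sum_integral_adjacent_intervals (a := t) (n := j)
    (μ := MeasureTheory.volume) (f := fun s => omega (1 - α) (t j - s) * omega γ s) (fun k hk =>
      intervalIntegrable_omega_mul_omega (by linarith) hγ (ht.pos hj1 hj)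
        (ht.nonneg (by omega)) (ht.mono (by omega) (by omega)) (ht.mono (by omega) (by omega)))
  rw [ht.zero] at hsplit
  rw [← integral_omega_mul_omega (by linarith) hγ (ht.pos hj1 hj), ← hsplit,
    sum_Icc_one_eq_sum_range, Finset.mul_sum]
  refine Finset.sum_le_sum fun i hi => ?_
  rw [Finset.mem_range] at hi
  obtain ⟨h1, h2⟩ := hX (i + 1) (by omega) (by omega)
  have h3 := integral_omega_le_kernelA hα hα' ht hρ (show 1 ≤ i + 1 by omega)
    (show i + 1 ≤ j by omega) hj
  rw [← mul_assoc]
  exact h2.trans (mul_le_mul_of_nonneg_right h3 h1)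

theorem sum_complementary_omega_le_of_bound {γ B : ℝ} (hα : 0 < α) (hα' : α < 1)
    (ht : IsTimeMesh t N T) (hρ : StepRatioBound t N) (hγ : 0 < γ) (hn : n ≤ N) {X : ℕ → ℝ}
    (hX : ∀ i, 1 ≤ i → i < n → 0 ≤ X i)
    (hX' : ∀ j < n, ∀ i, 1 ≤ i → i ≤ j →
      ∫ s in (t (i - 1))..(t i), omega (1 - α) (t j - s) * omega γ s ≤
        (∫ s in (t (i - 1))..(t i), omega (1 - α) (t j - s)) / step t i * X i)
    (hB : ∑ i ∈ Ico 1 n, X i ≤ B) :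
    ∑ j ∈ Ico 1 n, complementary (kernelA α t) n (n - j) * omega (1 - α + γ) (t j)
      ≤ 11 / 4 * B := by
  have hA := isMonotoneKernel_kernelA hα hα' ht hρ
  have h := hA.sum_Ico_complementary_conv_le hn (X := X) fun k hk => by
    rw [Finset.mem_Ico] at hk; exact hX k hk.1 hk.2
  calc _ ≤ ∑ j ∈ Ico 1 n, complementary (kernelA α t) n (n - j) *
        (11 / 4 * ∑ i ∈ Icc 1 j, kernelA α t j (j - i) * X i) := by
        refine Finset.sum_le_sum fun j hj => ?_
        rw [Finset.mem_Ico] at hj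
        refine mul_le_mul_of_nonneg_left ?_ (hA.complementary_nonneg hn (by omega))
        exact omega_conv_le hα hα' ht hρ hγ hj.1 (by omega) fun i hi hij =>
          ⟨hX i hi (by omega), hX' j hj.2 i hi hij⟩
    _ = 11 / 4 * ∑ j ∈ Ico 1 n, complementary (kernelA α t) n (n - j) *
        ∑ i ∈ Icc 1 j, kernelA α t j (j - i) * X i := by
        rw [Finset.mul_sum]; exact Finset.sum_congr rfl fun j _ => by ring
    _ ≤ _ := by linarith

theorem sum_complementary_omega_le {γ : ℝ} (hα : 0 < α) (hα' : α < 1) (ht : IsTimeMesh t N T)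
    (hρ : StepRatioBound t N) (hγ : 0 < γ) (hn1 : 1 ≤ n) (hn : n ≤ N) :
    ∑ j ∈ Ico 1 n, complementary (kernelA α t) n (n - j) * omega (1 - α + γ) (t j)
      ≤ 77 / 16 * omega (γ + 1) (t n) := by
  have hmono : ∀ i j, i ≤ j → j ≤ N → omega (γ + 1) (t i) ≤ omega (γ + 1) (t j) :=
    fun i j hij hj => omega_mono (by linarith) (ht.nonneg (by omega)) (ht.mono hij hj)
  have h0 : ∀ i ≤ N, 0 ≤ omega (γ + 1) (t i) := fun i hi =>
    omega_nonneg (by linarith) (ht.nonneg hi)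
  have hz : omega (γ + 1) (t 0) = 0 := by rw [ht.zero, omega_add_one_zero hγ]
  rw [show (77 : ℝ) / 16 * omega (γ + 1) (t n) = 11 / 4 * (7 / 4 * omega (γ + 1) (t n)) by ring]
  -- For `γ ≤ 1` the factors are oppositely ordered, so Chebyshev's inequality allows `X i = ∫ ω_γ`
  -- over the cell, and the sum telescopes. For `γ ≥ 1` both increase and `ω_γ` is replaced by its
  -- right endpoint value.
  rcases le_total γ 1 with hγ1 | hγ1
  · refine sum_complementary_omega_le_of_bound hα hα' ht hρ hγ hn
      (X := fun i => omega (γ + 1) (t i) - omega (γ + 1) (t (i - 1)))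
      (fun i hi hin => sub_nonneg.2 (hmono _ _ (by omega) (by omega)))
      (fun j hj i hi hij => ?_) ?_
    · exact integral_omega_mul_omega_le_of_le_one (by linarith) (by linarith) hγ hγ1
        (ht.nonneg (by omega)) (sub_pos.1 (ht.step_pos hi (by omega))) (ht.mono hij (by omega))
    · have : ∑ i ∈ Ico 1 n, (omega (γ + 1) (t i) - omega (γ + 1) (t (i - 1)))
          = omega (γ + 1) (t (n - 1)) - omega (γ + 1) (t 0) := by
        rw [← Finset.sum_range_sub (fun i => omega (γ + 1) (t i)) (n - 1),
          Finset.sum_Ico_eq_sum_range]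
        exact Finset.sum_congr rfl fun i _ => by rw [Nat.add_sub_cancel_left, add_comm 1 i]
      rw [this]
      linarith [hmono (n - 1) n (by omega) hn, h0 n hn]
  · refine sum_complementary_omega_le_of_bound hα hα' ht hρ hγ hn
      (X := fun i => step t i * omega γ (t i))
      (fun i hi hin => mul_nonneg (ht.step_pos hi (by omega)).le
        (omega_nonneg hγ (ht.nonneg (by omega))))
      (fun j hj i hi hij => ?_) ?_
    · exact integral_omega_mul_omega_le_of_one_le (by linarith) hγ1
        (ht.nonneg (by omega)) (sub_pos.1 (ht.step_pos hi (by omega))) (ht.mono hij (by omega))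
    -- The step-ratio bound turns the right endpoint rule on cell `i` into a left endpoint rule on
    -- cell `i + 1`, which lies below the integral of the increasing `ω_γ`. Cell `i + 1` exists
    -- because `i < n`.
    · have h1 : ∀ i ∈ Finset.Ico 1 n, step t i * omega γ (t i) ≤
          7 / 4 * (omega (γ + 1) (t (i + 1)) - omega (γ + 1) (t i)) := fun i hi => by
        rw [Finset.mem_Ico] at hi
        have h2 := ht.step_pos (show 1 ≤ i + 1 by omega) (by omega)
        have hr := hρ i hi.1 (by omega)
        rw [ratio, div_le_iff₀ h2] at hr
        have hm := ht.mono (show i ≤ i + 1 by omega) (by omega)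
        have h3 : ∫ _ in (t i)..(t (i + 1)), omega γ (t i) ≤
            ∫ s in (t i)..(t (i + 1)), omega γ s :=
          intervalIntegral.integral_mono_on hm (by simp) (intervalIntegrable_omega hγ _ _)
            fun s hs => omega_mono hγ1 (ht.nonneg (by omega)) hs.1
        rw [intervalIntegral.integral_const, smul_eq_mul, integral_omega hγ,
          show t (i + 1) - t i = step t (i + 1) from rfl] at h3
        have h4 := mul_le_mul_of_nonneg_right hr
          (omega_nonneg hγ (ht.nonneg (show i ≤ N by omega)))
        linarith
      refine (Finset.sum_le_sum h1).trans ?_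
      rw [← Finset.mul_sum, Finset.sum_Ico_sub (fun i => omega (γ + 1) (t i)) hn1]
      linarith [h0 1 (by omega)]

theorem sum_complementary_omega_one_sub_le (hα : 0 < α) (hα' : α < 1) (ht : IsTimeMesh t N T)
    (hρ : StepRatioBound t N) (hn1 : 1 ≤ n) (hn : n ≤ N) :
    ∑ j ∈ Icc 1 n, complementary (kernelA α t) n (n - j) * omega (1 - α) (t j) ≤ 11 / 4 := by
  have hA := isMonotoneKernel_kernelA hα hα' ht hρ
  calc _ ≤ ∑ j ∈ Icc 1 n, 11 / 4 * (complementary (kernelA α t) n (n - j) *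
        kernelA α t j (j - 1)) := by
        refine Finset.sum_le_sum fun j hj => ?_
        rw [Finset.mem_Icc] at hj
        have h1 := integral_omega_le_kernelA hα hα' ht hρ le_rfl hj.1 (hj.2.trans hn)
        have h2 := ht.step_pos le_rfl (show 1 ≤ N by omega)
        have hm := ht.mono hj.1 (hj.2.trans hn)
        -- Since `t j - s ≤ t j`, the average over the first cell dominates the value at `t j`; it
        -- is then bounded by `A^{(j)}_{j-1}`, whose `P`-weighted sum is one.
        have h3 : ∫ _ in (t (1 - 1))..(t 1), omega (1 - α) (t j) ≤
            ∫ s in (t (1 - 1))..(t 1), omega (1 - α) (t j - s) := by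
          refine integral_mono_on_of_le_Ioo (sub_pos.1 h2).le (by simp)
            (intervalIntegrable_omega_sub (by linarith) _ _ _) fun s hs => ?_
          have := hs.1
          rw [Nat.sub_self, ht.zero] at this
          exact omega_anti (by linarith) (by linarith) (by linarith [hs.2]) (by linarith)
        rw [intervalIntegral.integral_const, smul_eq_mul,
          show t 1 - t (1 - 1) = step t 1 from rfl] at h3
        rw [div_le_iff₀ h2] at h1
        have h4 : omega (1 - α) (t j) ≤ 11 / 4 * kernelA α t j (j - 1) :=
          le_of_mul_le_mul_left (by linarith) h2
        have h5 := hA.complementary_nonneg hn (show n - j < n by omega)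
        nlinarith
    _ = 11 / 4 := by rw [← Finset.mul_sum, hA.sum_complementary_mul hn le_rfl hn1, mul_one]

theorem one_le_mul_kernelA_zero (hα : 0 < α) (hα' : α < 1) (ht : IsTimeMesh t N T)
    (hρ : StepRatioBound t N) (hn1 : 1 ≤ n) (hn : n ≤ N) :
    1 ≤ 11 / 4 * Real.Gamma (2 - α) * step t n ^ α * kernelA α t n 0 := by
  have h := integral_omega_le_kernelA hα hα' ht hρ hn1 le_rfl hn
  have hs := ht.step_pos hn1 hn
  have hG : 0 < Real.Gamma (2 - α) := Real.Gamma_pos_of_pos (by linarith)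
  rw [integral_omega_sub (by linarith), sub_self, omega_add_one_zero (by linarith), sub_zero,
    Nat.sub_self, show t n - t (n - 1) = step t n from rfl, omega, add_sub_cancel_right,
    Real.rpow_sub hs, Real.rpow_one, show 1 - α + 1 = 2 - α by ring] at h
  have hp := Real.rpow_pos_of_pos hs α
  rw [show step t n / step t n ^ α / Real.Gamma (2 - α) / step t n
    = 1 / (Real.Gamma (2 - α) * step t n ^ α) by field_simp, div_le_iff₀ (by positivity)] at h
  linarith

end Powers

/-! ### The Mittag-Leffler function -/

/-- Only the tail `s > R` of the Gamma integral is kept. With `R^α = 2z + 1` this bounds the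
Mittag-Leffler series by a geometric one of ratio `z / (2z + 1) < 1`. -/
theorem rpow_mul_exp_neg_le_Gamma {x R : ℝ} (hx : 1 ≤ x) (hR : 0 < R) :
    R ^ (x - 1) * Real.exp (-R) ≤ Real.Gamma x := by
  rw [Real.Gamma_eq_integral (by linarith), ← integral_exp_neg_Ioi, ← MeasureTheory.integral_const_mul]
  have hi := Real.GammaIntegral_convergent (show 0 < x by linarith)
  have hsub : Ioi R ⊆ Ioi (0 : ℝ) := Ioi_subset_Ioi hR.le
  refine le_trans (MeasureTheory.setIntegral_mono_on ((integrableOn_exp_neg_Ioi R).const_mul _)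
    (hi.mono_set hsub) measurableSet_Ioi fun s hs => ?_)
    (MeasureTheory.setIntegral_mono_set hi ?_ hsub.eventuallyLE)
  · rw [mul_comm]
    exact mul_le_mul_of_nonneg_left (Real.rpow_le_rpow hR.le (le_of_lt hs) (by linarith))
      (Real.exp_pos _).le
  · refine (MeasureTheory.ae_restrict_mem measurableSet_Ioi).mono fun s hs => ?_
    exact mul_nonneg (Real.exp_pos _).le (Real.rpow_nonneg (le_of_lt hs) _)

theorem Gamma_one_add_nat_mul_pos {α : ℝ} (hα : 0 < α) (k : ℕ) : 0 < Real.Gamma (1 + k * α) :=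
  Real.Gamma_pos_of_pos (by positivity)

theorem summable_mittagLeffler {α z : ℝ} (hα : 0 < α) (hz : 0 ≤ z) :
    Summable fun k : ℕ => z ^ k / Real.Gamma (1 + k * α) := by
  set R : ℝ := (2 * z + 1) ^ (1 / α) with hRdef
  have hR : 0 < R := Real.rpow_pos_of_pos (by linarith) _
  have hRα : R ^ α = 2 * z + 1 := by
    rw [hRdef, ← Real.rpow_mul (by linarith), one_div_mul_cancel hα.ne', Real.rpow_one]
  have hr : z / (2 * z + 1) < 1 := by rw [div_lt_one (by linarith)]; linarith
  refine Summable.of_nonneg_of_le (fun k => div_nonneg (pow_nonneg hz k)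
    (Gamma_one_add_nat_mul_pos hα k).le) (fun k => ?_)
    ((summable_geometric_of_lt_one (by positivity) hr).mul_left (Real.exp R))
  have h := rpow_mul_exp_neg_le_Gamma (x := 1 + k * α) (R := R)
    (by have := mul_nonneg k.cast_nonneg hα.le; linarith) hR
  rw [add_sub_cancel_left, mul_comm (k : ℝ) α, Real.rpow_mul hR.le, hRα,
    Real.rpow_natCast, mul_comm α] at h
  calc z ^ k / Real.Gamma (1 + k * α) ≤ z ^ k / ((2 * z + 1) ^ k * Real.exp (-R)) := by gcongr
    _ = _ := by rw [div_pow, Real.exp_neg]; field_simp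

theorem one_le_mittagLeffler {α z : ℝ} (hα : 0 < α) (hz : 0 ≤ z) : 1 ≤ mittagLeffler α z := by
  have h := (summable_mittagLeffler hα hz).le_tsum 0 fun k _ =>
    div_nonneg (pow_nonneg hz k) (Gamma_one_add_nat_mul_pos hα k).le
  simpa [mittagLeffler] using h

theorem mittagLeffler_mono {α z w : ℝ} (hα : 0 < α) (hz : 0 ≤ z) (hzw : z ≤ w) :
    mittagLeffler α z ≤ mittagLeffler α w :=
  (summable_mittagLeffler hα hz).tsum_le_tsum (fun k => by
    have := Gamma_one_add_nat_mul_pos hα k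
    gcongr) (summable_mittagLeffler hα (hz.trans hzw))

theorem pow_div_Gamma_eq {α l x : ℝ} (hx : 0 ≤ x) (k : ℕ) :
    (l * x ^ α) ^ k / Real.Gamma (1 + k * α) = l ^ k * omega (1 + k * α) x := by
  rw [omega, add_sub_cancel_left, mul_pow, ← Real.rpow_natCast (x ^ α), ← Real.rpow_mul hx,
    mul_comm α, mul_div_assoc]

/-- Applying `P` to the `k`-th term of the series gives, up to `77/16`, the term of index `k + 1`;
only the leading `1` is missing on the right. -/
theorem mul_sum_complementary_mittagLeffler_le {α l : ℝ} {t : ℕ → ℝ} {N n : ℕ} {T : ℝ}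
    (hα : 0 < α) (hα' : α < 1) (ht : IsTimeMesh t N T) (hρ : StepRatioBound t N) (hl : 0 ≤ l)
    (hn1 : 1 ≤ n) (hn : n ≤ N) :
    l * ∑ j ∈ Finset.Ico 1 n,
        complementary (kernelA α t) n (n - j) * mittagLeffler α (l * t j ^ α)
      ≤ 77 / 16 * (mittagLeffler α (l * t n ^ α) - 1) := by
  have hz : ∀ j ≤ N, 0 ≤ l * t j ^ α := fun j hj =>
    mul_nonneg hl (Real.rpow_nonneg (ht.nonneg hj) _)
  have h1 : HasSum (fun k : ℕ => l * ∑ j ∈ Finset.Ico 1 n,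
      complementary (kernelA α t) n (n - j) * ((l * t j ^ α) ^ k / Real.Gamma (1 + k * α)))
      (l * ∑ j ∈ Finset.Ico 1 n,
        complementary (kernelA α t) n (n - j) * mittagLeffler α (l * t j ^ α)) := by
    refine (hasSum_sum fun j hj => ?_).mul_left l
    rw [Finset.mem_Ico] at hj
    exact (summable_mittagLeffler hα (hz j (by omega))).hasSum.mul_left _
  have hs := summable_mittagLeffler hα (hz n hn)
  have h2 : HasSum (fun k : ℕ => 77 / 16 *
      ((l * t n ^ α) ^ (k + 1) / Real.Gamma (1 + (k + 1 : ℕ) * α)))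
      (77 / 16 * (mittagLeffler α (l * t n ^ α) - 1)) := by
    refine HasSum.mul_left _ ?_
    have := (hasSum_nat_add_iff' 1).2 hs.hasSum
    simpa [mittagLeffler] using this
  refine hasSum_le (fun k => ?_) h1 h2
  rw [pow_div_Gamma_eq (ht.nonneg hn)]
  have h3 : ∀ j ∈ Finset.Ico 1 n, complementary (kernelA α t) n (n - j) *
      ((l * t j ^ α) ^ k / Real.Gamma (1 + k * α))
      = l ^ k * (complementary (kernelA α t) n (n - j) * omega (1 - α + (k + 1) * α) (t j)) := by
    intro j hj
    rw [Finset.mem_Ico] at hj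
    rw [pow_div_Gamma_eq (ht.nonneg (by omega)), show 1 - α + (k + 1) * α = 1 + k * α by ring]
    ring
  rw [Finset.sum_congr rfl h3, ← Finset.mul_sum]
  have h4 := sum_complementary_omega_le hα hα' ht hρ (γ := (k + 1) * α) (by positivity) hn1 hn
  calc _ = l ^ (k + 1) * ∑ j ∈ Finset.Ico 1 n,
        complementary (kernelA α t) n (n - j) * omega (1 - α + (k + 1) * α) (t j) := by ring
    _ ≤ l ^ (k + 1) * (77 / 16 * omega ((k + 1) * α + 1) (t n)) := by gcongr
    _ = _ := by push_cast; rw [add_comm 1]; ring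

end FracCN

namespace FracCN

open Finset

/-! ### The spatial grid -/

section Grid

variable {xl xr : ℝ} {M : ℕ}

theorem width_pos (hx : xl < xr) (hM : 1 ≤ M) : 0 < width xl xr M :=
  div_pos (sub_pos.2 hx) (by exact_mod_cast hM)

theorem pt_mem_Ioo (hx : xl < xr) (hM : 1 ≤ M) {r : ℝ} (hr : 0 < r) (hrM : r < M) :
    pt xl xr M r ∈ Set.Ioo xl xr := by
  have hh := width_pos hx hM
  have hM' : (0 : ℝ) < M := by exact_mod_cast hM
  have h1 : (M : ℝ) * width xl xr M = xr - xl := mul_div_cancel₀ _ hM'.ne'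
  constructor <;> unfold pt <;> nlinarith

theorem midpoint_mem_Ioo (hx : xl < xr) (hM : 1 ≤ M) {i : ℕ} (hi : i < M) :
    pt xl xr M (i + 1 / 2) ∈ Set.Ioo xl xr := by
  have : (i : ℝ) + 1 ≤ M := by exact_mod_cast hi
  exact pt_mem_Ioo hx hM (by positivity) (by linarith)

theorem sum_range_diff_mul (v F : ℕ → ℝ) (m : ℕ) :
    ∑ i ∈ range (m + 1), (v (i + 1) - v i) * F i =
      v (m + 1) * F m - v 0 * F 0 - ∑ i ∈ range m, v (i + 1) * (F (i + 1) - F i) := by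
  induction m with
  | zero => simp; ring
  | succ m ih => rw [Finset.sum_range_succ, ih, Finset.sum_range_succ _ m]; ring

/-- Summation by parts for the difference operator. -/
theorem ip_Lh (hx : xl < xr) (hM : 1 ≤ M) (μ : ℝ → ℝ) {v : ℕ → ℝ}
    (hv : VanishesOnBoundary M v) (w : ℕ → ℝ) :
    ip xl xr M v (Lh xl xr μ M w) = ∑ i ∈ range M,
      μ (pt xl xr M (i + 1 / 2)) / width xl xr M * ((v (i + 1) - v i) * (w (i + 1) - w i)) := by
  obtain ⟨m, rfl⟩ : ∃ m, M = m + 1 := ⟨M - 1, by omega⟩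
  have hh := (width_pos hx hM).ne'
  have h := sum_range_diff_mul v (fun i => μ (pt xl xr (m + 1) (i + 1 / 2)) *
    ((w (i + 1) - w i) / width xl xr (m + 1))) m
  rw [hv.1, hv.2] at h
  have h1 : ∑ i ∈ range (m + 1), μ (pt xl xr (m + 1 : ℕ) (i + 1 / 2)) / width xl xr (m + 1 : ℕ) *
      ((v (i + 1) - v i) * (w (i + 1) - w i)) =
      ∑ i ∈ range (m + 1), (v (i + 1) - v i) * (μ (pt xl xr (m + 1) (i + 1 / 2)) *
      ((w (i + 1) - w i) / width xl xr (m + 1))) := Finset.sum_congr rfl fun i _ => by ring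
  rw [h1, h, ip, show Ioo 0 (m + 1) = Icc 1 m by ext; simp only [mem_Ioo, mem_Icc]; omega,
    sum_Icc_one_eq_sum_range, Finset.mul_sum, zero_mul, zero_mul, sub_zero, zero_sub,
    ← Finset.sum_neg_distrib]
  refine Finset.sum_congr rfl fun i _ => ?_
  rw [Lh, Nat.add_sub_cancel, show ((i + 1 : ℕ) : ℝ) - 1 / 2 = i + 1 / 2 by push_cast; ring]
  field_simp

variable {μ : ℝ → ℝ}

theorem semiH1_sq (hx : xl < xr) (hM : 1 ≤ M) (hμ : ∀ x ∈ Set.Ioo xl xr, 0 ≤ μ x) {v : ℕ → ℝ}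
    (hv : VanishesOnBoundary M v) :
    semiH1 xl xr μ M v ^ 2 = ∑ i ∈ range M,
      μ (pt xl xr M (i + 1 / 2)) / width xl xr M * (v (i + 1) - v i) ^ 2 := by
  have h := ip_Lh hx hM μ hv v
  simp_rw [← sq] at h
  rw [semiH1, Real.sq_sqrt, h]
  rw [h]
  exact Finset.sum_nonneg fun i hi => mul_nonneg (div_nonneg
    (hμ _ (midpoint_mem_Ioo hx hM (mem_range.1 hi))) (width_pos hx hM).le) (sq_nonneg _)

theorem normL2_sq (hx : xl < xr) (hM : 1 ≤ M) (v : ℕ → ℝ) :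
    normL2 xl xr M v ^ 2 = width xl xr M * ∑ i ∈ Ioo 0 M, v i ^ 2 := by
  rw [normL2, Real.sq_sqrt, ip]
  · simp_rw [sq]
  · exact mul_nonneg (width_pos hx hM).le (Finset.sum_nonneg fun i _ => mul_self_nonneg _)

theorem normH1_sq (xl xr : ℝ) (μ : ℝ → ℝ) (M : ℕ) (v : ℕ → ℝ) :
    normH1 xl xr μ M v ^ 2 = normL2 xl xr M v ^ 2 + semiH1 xl xr μ M v ^ 2 := by
  rw [normH1, Real.sq_sqrt (by positivity)]

theorem sq_le_mul_sum_sq_diff {v : ℕ → ℝ} (hv : v 0 = 0) {i : ℕ} (hi : i ≤ M) :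
    v i ^ 2 ≤ M * ∑ k ∈ range M, (v (k + 1) - v k) ^ 2 := by
  have h1 : v i = ∑ k ∈ range i, (v (k + 1) - v k) := by rw [Finset.sum_range_sub, hv, sub_zero]
  have h2 := sq_sum_le_card_mul_sum_sq (s := range i) (f := fun k => v (k + 1) - v k)
  rw [← h1, card_range] at h2
  refine h2.trans ?_
  have h3 : ∑ k ∈ range i, (v (k + 1) - v k) ^ 2 ≤ ∑ k ∈ range M, (v (k + 1) - v k) ^ 2 :=
    Finset.sum_le_sum_of_subset_of_nonneg (range_mono hi) fun _ _ _ => sq_nonneg _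
  gcongr

/-- Cauchy–Schwarz from the left boundary point bounds each `v i ^ 2` by `M S`, with `S` the sum of
squared differences; summation gives `h M² S`, and `(h M)² = (xr - xl)²`. -/
theorem isEmbeddingConst {μ₀ μ₁ : ℝ} (hx : xl < xr) (hμ₀ : 0 < μ₀) :
    IsEmbeddingConst xl xr μ₀ μ₁ ((xr - xl) ^ 2 / μ₀) := by
  have hl := sub_pos.2 hx
  refine ⟨by positivity, fun μ hμ M hM v hv => ?_⟩
  have hh := width_pos hx hM
  have hM' : (0 : ℝ) < M := by exact_mod_cast hM
  rw [normL2_sq hx hM, semiH1_sq hx hM (fun x hx => hμ₀.le.trans (hμ x hx).1) hv]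
  set S := ∑ k ∈ range M, (v (k + 1) - v k) ^ 2 with hS
  have hS0 : 0 ≤ S := Finset.sum_nonneg fun _ _ => sq_nonneg _
  have h1 : ∑ i ∈ Ioo 0 M, v i ^ 2 ≤ M * (M * S) := by
    calc _ ≤ ∑ i ∈ Ioo 0 M, (M * S) :=
          Finset.sum_le_sum fun i hi => sq_le_mul_sum_sq_diff hv.1 (mem_Ioo.1 hi).2.le
      _ = ((M - 0 - 1 : ℕ) : ℝ) * (M * S) := by rw [Finset.sum_const, Nat.card_Ioo, nsmul_eq_mul]
      _ ≤ _ := by gcongr; omega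
  have h2 : μ₀ / width xl xr M * S ≤ ∑ i ∈ range M,
      μ (pt xl xr M (i + 1 / 2)) / width xl xr M * (v (i + 1) - v i) ^ 2 := by
    rw [hS, Finset.mul_sum]
    refine Finset.sum_le_sum fun i hi => ?_
    have := (hμ _ (midpoint_mem_Ioo hx hM (mem_range.1 hi))).1
    gcongr
  calc _ ≤ width xl xr M * (M * (M * S)) := by gcongr
    _ = (xr - xl) ^ 2 / μ₀ * (μ₀ / width xl xr M * S) := by unfold width; field_simp
    _ ≤ _ := by gcongr

end Grid

theorem le_maxUpTo {n k : ℕ} (hn : 1 ≤ n) (g : ℕ → ℝ) (hk : 1 ≤ k) (hkn : k ≤ n) :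
    g k ≤ maxUpTo n hn g :=
  Finset.le_sup' g (mem_Icc.2 ⟨hk, hkn⟩)

/-! ### Stability of the scheme -/

section Scheme

variable {xl xr : ℝ} {μ c : ℝ → ℝ} {f : ℝ → ℝ → ℝ} {u₀ : ℝ → ℝ} {α T : ℝ} {t : ℕ → ℝ} {N M n : ℕ}
  {u : ℕ → ℕ → ℝ}

/-- The weighted energy inequality in the discrete `H¹` semi-norm. -/
theorem semiH1_energy (hx : xl < xr) (hM : 1 ≤ M) (hμ : ∀ x ∈ Set.Ioo xl xr, 0 ≤ μ x)
    (hα : 0 < α) (hα' : α < 1) (ht : IsTimeMesh t N T) (hρ : StepRatioBound t N)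
    (hu : ∀ k ≤ N, VanishesOnBoundary M (u k)) (hn1 : 1 ≤ n) (hn : n ≤ N) :
    1 / 2 * ∑ k ∈ Icc 1 n, kernelA α t n (n - k) *
        (semiH1 xl xr μ M (u k) ^ 2 - semiH1 xl xr μ M (u (k - 1)) ^ 2) ≤
      ip xl xr M (fun i => discreteCaputo α t (fun k => u k i) n)
        (Lh xl xr μ M fun j => offset (α / 2) (fun k => u k j) n) := by
  have hA := isMonotoneKernel_kernelA hα hα' ht hρ
  have hb : VanishesOnBoundary M fun i => discreteCaputo α t (fun k => u k i) n := by
    constructor <;> refine Finset.sum_eq_zero fun k hk => ?_ <;> rw [mem_Icc] at hk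
    · dsimp only
      rw [(hu k (by omega)).1, (hu (k - 1) (by omega)).1, sub_zero, mul_zero]
    · dsimp only
      rw [(hu k (by omega)).2, (hu (k - 1) (by omega)).2, sub_zero, mul_zero]
  rw [ip_Lh hx hM μ hb]
  have h1 : 1 / 2 * ∑ k ∈ Icc 1 n, kernelA α t n (n - k) *
        (semiH1 xl xr μ M (u k) ^ 2 - semiH1 xl xr μ M (u (k - 1)) ^ 2) =
      ∑ i ∈ range M, μ (pt xl xr M (i + 1 / 2)) / width xl xr M *
        (1 / 2 * ∑ k ∈ Icc 1 n, kernelA α t n (n - k) *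
          ((u k (i + 1) - u k i) ^ 2 - (u (k - 1) (i + 1) - u (k - 1) i) ^ 2)) := by
    simp_rw [Finset.mul_sum]
    rw [Finset.sum_comm]
    refine Finset.sum_congr rfl fun k hk => ?_
    rw [mem_Icc] at hk
    rw [semiH1_sq hx hM hμ (hu k (by omega)), semiH1_sq hx hM hμ (hu (k - 1) (by omega)),
      ← Finset.sum_sub_distrib, Finset.mul_sum, Finset.mul_sum]
    exact Finset.sum_congr rfl fun i _ => by ring
  rw [h1]
  refine Finset.sum_le_sum fun i hi => mul_le_mul_of_nonneg_left ?_ (div_nonneg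
    (hμ _ (midpoint_mem_Ioo hx hM (mem_range.1 hi))) (width_pos hx hM).le)
  -- The scalar energy inequality is applied to each spatial difference separately, with weight `μ /
  -- h ≥ 0`.
  refine (hA.energy hn1 hn (θ := α / 2) (by linarith) (by linarith)
    (fun h2 => kernelA_one_le hα hα' ht hρ h2 hn) fun k => u k (i + 1) - u k i).trans_eq ?_
  unfold discreteCaputo offset
  rw [← Finset.sum_sub_distrib]
  congr 1
  · exact Finset.sum_congr rfl fun k _ => by ring
  · ring

theorem semiH1_offset_sq_le (hx : xl < xr) (hM : 1 ≤ M) (hμ : ∀ x ∈ Set.Ioo xl xr, 0 ≤ μ x)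
    {θ : ℝ} (hθ : 0 ≤ θ) (hθ' : θ ≤ 1) (hu : VanishesOnBoundary M (u n))
    (hu' : VanishesOnBoundary M (u (n - 1))) :
    VanishesOnBoundary M (fun j => offset θ (fun k => u k j) n) ∧
    semiH1 xl xr μ M (fun j => offset θ (fun k => u k j) n) ^ 2 ≤
      offset θ (fun k => semiH1 xl xr μ M (u k) ^ 2) n := by
  have hb : VanishesOnBoundary M (fun j => offset θ (fun k => u k j) n) := by
    constructor <;> simp [offset, hu.1, hu.2, hu'.1, hu'.2]
  refine ⟨hb, ?_⟩
  rw [semiH1_sq hx hM hμ hb]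
  simp only [offset]
  rw [semiH1_sq hx hM hμ hu, semiH1_sq hx hM hμ hu', Finset.mul_sum, Finset.mul_sum,
    ← Finset.sum_add_distrib]
  refine Finset.sum_le_sum fun i hi => ?_
  have h0 := div_nonneg (hμ _ (midpoint_mem_Ioo hx hM (mem_range.1 hi))) (width_pos hx hM).le
  have h1 : (θ * u (n - 1) (i + 1) + (1 - θ) * u n (i + 1)
      - (θ * u (n - 1) i + (1 - θ) * u n i)) ^ 2 ≤
      θ * (u (n - 1) (i + 1) - u (n - 1) i) ^ 2 + (1 - θ) * (u n (i + 1) - u n i) ^ 2 := by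
    nlinarith [mul_nonneg (mul_nonneg hθ (sub_nonneg.2 hθ'))
      (sq_nonneg ((u (n - 1) (i + 1) - u (n - 1) i) - (u n (i + 1) - u n i)))]
  have h2 := mul_le_mul_of_nonneg_left h1 h0
  linarith

/-- Testing the scheme with `𝓛_h u^{n-θ}`. -/
theorem IsSolution.sum_kernelA_semiH1_le {C κ : ℝ} (hx : xl < xr) (hM : 1 ≤ M)
    (hμ : ∀ x ∈ Set.Ioo xl xr, 0 ≤ μ x) (hC : ∀ v : ℕ → ℝ, VanishesOnBoundary M v →
      normL2 xl xr M v ^ 2 ≤ C * semiH1 xl xr μ M v ^ 2) (hC0 : 0 ≤ C)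
    (hc : ∀ x ∈ Set.Ioo xl xr, |c x| ≤ κ)
    (hα : 0 < α) (hα' : α < 1) (ht : IsTimeMesh t N T) (hρ : StepRatioBound t N)
    (hu : IsSolution xl xr μ c f u₀ α t N M u) (hn1 : 1 ≤ n) (hn : n ≤ N) :
    ∑ k ∈ Icc 1 n, kernelA α t n (n - k) *
        (semiH1 xl xr μ M (u k) ^ 2 - semiH1 xl xr μ M (u (k - 1)) ^ 2) ≤
      κ ^ 2 * C * offset (α / 2) (fun k => semiH1 xl xr μ M (u k) ^ 2) n
        + sourceSq xl xr f α t M n := by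
  have h1 := semiH1_energy hx hM hμ hα hα' ht hρ hu.boundary hn1 hn
  obtain ⟨hb, h2⟩ := semiH1_offset_sq_le hx hM hμ (θ := α / 2) (by linarith) (by linarith)
    (hu.boundary n hn) (hu.boundary (n - 1) (by omega))
  have h3 := hC _ hb
  set W : ℕ → ℝ := fun j => offset (α / 2) (fun k => u k j) n with hW
  have h4 : ip xl xr M (fun i => discreteCaputo α t (fun k => u k i) n) (Lh xl xr μ M W) ≤
      1 / 2 * (κ ^ 2 * normL2 xl xr M W ^ 2 + sourceSq xl xr f α t M n) := by
    rw [sourceSq, normL2_sq hx hM, normL2_sq hx hM, ip]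
    rw [show ∀ a b h k : ℝ, 1 / 2 * (k * (h * a) + h * b) = h * (1 / 2 * (k * a + b)) from
      fun a b h k => by ring]
    refine mul_le_mul_of_nonneg_left ?_ (width_pos hx hM).le
    rw [Finset.mul_sum, ← Finset.sum_add_distrib, Finset.mul_sum]
    refine Finset.sum_le_sum fun i hi => ?_
    rw [mem_Ioo] at hi
    have e1 := hu.equation n hn1 hn i hi.1 hi.2
    have e2 := sq_le_sq.2 ((hc (pt xl xr M i) (pt_mem_Ioo hx hM (by exact_mod_cast hi.1)
      (by exact_mod_cast hi.2))).trans (le_abs_self κ))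
    have e3 : offset (α / 2) (fun k => u k i) n = W i := rfl
    rw [e3] at e1
    rw [eq_sub_of_add_eq e1]
    set l := Lh xl xr μ M W i
    set a := c (pt xl xr M i)
    set b := f (pt xl xr M i) (offset (α / 2) t n)
    -- Young twice: `(a W + b - l) l ≤ (a W + b)² / 4 ≤ (a² W² + b²) / 2`.
    nlinarith [sq_nonneg (l - (a * W i + b) / 2), sq_nonneg (a * W i - b),
      mul_le_mul_of_nonneg_right e2 (sq_nonneg (W i))]
  have h5 : κ ^ 2 * normL2 xl xr M W ^ 2 ≤
      κ ^ 2 * (C * offset (α / 2) (fun k => semiH1 xl xr μ M (u k) ^ 2) n) := by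
    gcongr
    exact h3.trans (by gcongr)
  linarith

theorem sum_complementary_mul_le (hα : 0 < α) (hα' : α < 1) (ht : IsTimeMesh t N T)
    (hρ : StepRatioBound t N) (hn1 : 1 ≤ n) (hn : n ≤ N) {g : ℕ → ℝ} {B : ℝ}
    (hB : ∀ k, 1 ≤ k → k ≤ n → t k ^ α * g k ≤ B) (hB0 : 0 ≤ B) :
    ∑ j ∈ Icc 1 n, complementary (kernelA α t) n (n - j) * g j ≤
      11 / 4 * Real.Gamma (1 - α) * B := by
  have hA := isMonotoneKernel_kernelA hα hα' ht hρ
  have hG : 0 < Real.Gamma (1 - α) := Real.Gamma_pos_of_pos (by linarith)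
  calc _ ≤ ∑ j ∈ Icc 1 n, complementary (kernelA α t) n (n - j) * omega (1 - α) (t j) *
        (Real.Gamma (1 - α) * B) := by
        refine Finset.sum_le_sum fun j hj => ?_
        rw [mem_Icc] at hj
        have hp := Real.rpow_pos_of_pos (ht.pos hj.1 (hj.2.trans hn)) α
        rw [mul_assoc]
        refine mul_le_mul_of_nonneg_left ?_ (hA.complementary_nonneg hn (by omega))
        rw [omega, show 1 - α - 1 = -α by ring, Real.rpow_neg (ht.nonneg (hj.2.trans hn)),
          div_mul_eq_mul_div, mul_left_comm, mul_div_cancel_left₀ _ hG.ne', inv_mul_eq_div,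
          le_div_iff₀ hp, mul_comm]
        exact hB j hj.1 hj.2
    _ ≤ 11 / 4 * (Real.Gamma (1 - α) * B) := by
        rw [← Finset.sum_mul]
        have := sum_complementary_omega_one_sub_le hα hα' ht hρ hn1 hn
        gcongr
    _ = _ := by ring

end Scheme

end FracCN

/-! ### The stability theorem. -/

theorem corollary4p2 (xl xr μ₀ μ₁ : ℝ) (hx : xl < xr) (hμ₀ : 0 < μ₀) (hμ₁ : μ₀ ≤ μ₁) :
    (∃ C : ℝ, FracCN.IsEmbeddingConst xl xr μ₀ μ₁ C) ∧
    ∀ C : ℝ, FracCN.IsEmbeddingConst xl xr μ₀ μ₁ C →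
    ∀ (α κ : ℝ), 0 < α → α < 1 → 0 ≤ κ →
    ∀ (μ c : ℝ → ℝ), (∀ x ∈ Set.Ioo xl xr, μ₀ ≤ μ x ∧ μ x ≤ μ₁) →
      (∀ x ∈ Set.Ioo xl xr, |c x| ≤ κ) →
    ∀ (f : ℝ → ℝ → ℝ) (u₀ : ℝ → ℝ) (T : ℝ) (t : ℕ → ℝ) (N M : ℕ) (hN : 1 ≤ N), 1 ≤ M →
      FracCN.IsTimeMesh t N T → FracCN.StepRatioBound t N →
      11 * Real.Gamma (2 - α) * κ ^ 2 * C * FracCN.maxStep t N hN ^ α ≤ 1 →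
    ∀ u : ℕ → ℕ → ℝ, FracCN.IsSolution xl xr μ c f u₀ α t N M u →
    ∀ (n : ℕ) (hn : 1 ≤ n), n ≤ N →
      FracCN.semiH1 xl xr μ M (u n) ^ 2
        ≤ 2 * FracCN.mittagLeffler α (77 / 4 * κ ^ 2 * C * t n ^ α) *
          (FracCN.semiH1 xl xr μ M (u 0) ^ 2 +
            FracCN.maxUpTo n hn (fun k => ∑ j ∈ Finset.Icc 1 k,
              FracCN.complementary (FracCN.kernelA α t) k (k - j) *
                FracCN.sourceSq xl xr f α t M j)) ∧
      2 * FracCN.mittagLeffler α (77 / 4 * κ ^ 2 * C * t n ^ α) *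
          (FracCN.semiH1 xl xr μ M (u 0) ^ 2 +
            FracCN.maxUpTo n hn (fun k => ∑ j ∈ Finset.Icc 1 k,
              FracCN.complementary (FracCN.kernelA α t) k (k - j) *
                FracCN.sourceSq xl xr f α t M j))
        ≤ 2 * FracCN.mittagLeffler α (77 / 4 * κ ^ 2 * C * t n ^ α) *
          (FracCN.semiH1 xl xr μ M (u 0) ^ 2 +
            11 / 4 * Real.Gamma (1 - α) *
              FracCN.maxUpTo n hn (fun k => t k ^ α * FracCN.sourceSq xl xr f α t M k)) ∧
      FracCN.normH1 xl xr μ M (u n) ^ 2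
        ≤ 2 * (1 + C) * FracCN.mittagLeffler α (77 / 4 * κ ^ 2 * C * t n ^ α) *
          (FracCN.normH1 xl xr μ M (u 0) ^ 2 +
            11 / 4 * Real.Gamma (1 - α) *
              FracCN.maxUpTo n hn (fun k => t k ^ α * FracCN.sourceSq xl xr f α t M k)) := by
  refine ⟨⟨_, FracCN.isEmbeddingConst hx hμ₀⟩, ?_⟩
  intro C hC α κ hα hα' hκ μ c hμ hc f u₀ T t N M hN hM ht hρ hτ u hu n hn1 hn
  have hμ' : ∀ x ∈ Set.Ioo xl xr, 0 ≤ μ x := fun x hx => hμ₀.le.trans (hμ x hx).1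
  have hA := FracCN.isMonotoneKernel_kernelA hα hα' ht hρ
  have hC0 := hC.1
  have hCM := hC.2 μ hμ M hM
  have hl : 0 ≤ 77 / 4 * κ ^ 2 * C := by positivity
  have hz : ∀ k ≤ N, 0 ≤ 77 / 4 * κ ^ 2 * C * t k ^ α := fun k hk =>
    mul_nonneg hl (Real.rpow_nonneg (ht.nonneg hk) _)
  have hE := FracCN.one_le_mittagLeffler hα (hz n hn)
  have hGamma : 0 < Real.Gamma (1 - α) := Real.Gamma_pos_of_pos (by linarith)
  have hsrc : ∀ k, 0 ≤ FracCN.sourceSq xl xr f α t M k := fun k => sq_nonneg _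
  -- The step-size condition enters here: `1 / A_0 ≤ 11/4 Γ(2-α) τ_m^α`, and `11 = 4 · 11/4`.
  have hP : ∀ m, 1 ≤ m → m ≤ N →
      κ ^ 2 * C * FracCN.complementary (FracCN.kernelA α t) m 0 ≤ 1 / 4 := by
    intro m hm1 hm
    have h1 := FracCN.one_le_mul_kernelA_zero hα hα' ht hρ hm1 hm
    have h2 := hA.pos m hm 0 hm1
    have h3 := ht.step_pos hm1 hm
    have h4 : FracCN.step t m ≤ FracCN.maxStep t N hN :=
      Finset.le_sup' (FracCN.step t) (Finset.mem_Icc.2 ⟨hm1, hm⟩)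
    have h5 : FracCN.step t m ^ α ≤ FracCN.maxStep t N hN ^ α :=
      Real.rpow_le_rpow h3.le h4 hα.le
    have h6 : 0 < Real.Gamma (2 - α) := Real.Gamma_pos_of_pos (by linarith)
    have h7 : 11 * Real.Gamma (2 - α) * κ ^ 2 * C * FracCN.step t m ^ α ≤ 1 :=
      le_trans (by gcongr) hτ
    have h8 : 0 < 11 / 4 * Real.Gamma (2 - α) * FracCN.step t m ^ α := by
      have := Real.rpow_pos_of_pos h3 α
      positivity
    rw [FracCN.complementary_zero, mul_one_div, div_le_iff₀ h2]
    have h9 : 11 / 4 * Real.Gamma (2 - α) * FracCN.step t m ^ α * (4 * (κ ^ 2 * C)) ≤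
        11 / 4 * Real.Gamma (2 - α) * FracCN.step t m ^ α * FracCN.kernelA α t m 0 := by
      linarith
    linarith [le_of_mul_le_mul_left h9 h8]
  have hmax : ∀ k, 1 ≤ k → k ≤ n → ∑ j ∈ Finset.Icc 1 k,
      FracCN.complementary (FracCN.kernelA α t) k (k - j) * FracCN.sourceSq xl xr f α t M j ≤
      FracCN.maxUpTo n hn1 (fun k => ∑ j ∈ Finset.Icc 1 k,
        FracCN.complementary (FracCN.kernelA α t) k (k - j) *
          FracCN.sourceSq xl xr f α t M j) := fun k hk1 hk =>
    FracCN.le_maxUpTo hn1 (fun k => ∑ j ∈ Finset.Icc 1 k,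
      FracCN.complementary (FracCN.kernelA α t) k (k - j) *
        FracCN.sourceSq xl xr f α t M j) hk1 hk
  have hmax0 := le_trans (Finset.sum_nonneg fun j hj => mul_nonneg
    (hA.complementary_nonneg (n := 1) (by omega) (m := 1 - j)
      (by rw [Finset.mem_Icc] at hj; omega)) (hsrc j)) (hmax 1 le_rfl hn1)
  have hmax1 : ∀ k, 1 ≤ k → k ≤ n → t k ^ α * FracCN.sourceSq xl xr f α t M k ≤
      FracCN.maxUpTo n hn1 (fun k => t k ^ α * FracCN.sourceSq xl xr f α t M k) :=
    fun k hk1 hk => FracCN.le_maxUpTo hn1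
      (fun k => t k ^ α * FracCN.sourceSq xl xr f α t M k) hk1 hk
  have hmax2 := le_trans (mul_nonneg (Real.rpow_nonneg (ht.nonneg (show 1 ≤ N by omega)) α)
    (hsrc 1)) (hmax1 1 le_rfl hn1)
  have hmax3 : FracCN.maxUpTo n hn1 (fun k => ∑ j ∈ Finset.Icc 1 k,
        FracCN.complementary (FracCN.kernelA α t) k (k - j) *
          FracCN.sourceSq xl xr f α t M j) ≤ 11 / 4 * Real.Gamma (1 - α) *
      FracCN.maxUpTo n hn1 (fun k => t k ^ α * FracCN.sourceSq xl xr f α t M k) := by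
    refine Finset.sup'_le _ _ fun k hk => ?_
    rw [Finset.mem_Icc] at hk
    exact FracCN.sum_complementary_mul_le hα hα' ht hρ hk.1 (by omega)
      (fun j hj1 hj => hmax1 j hj1 (by omega)) hmax2
  have h1 := hA.gronwall (V := fun k => FracCN.semiH1 xl xr μ M (u k) ^ 2)
    (g := FracCN.sourceSq xl xr f α t M) (L := κ ^ 2 * C) (θ := α / 2)
    (E := fun k => FracCN.mittagLeffler α (77 / 4 * κ ^ 2 * C * t k ^ α))
    (fun k => sq_nonneg _) (by linarith) (by linarith) (by positivity) hP
    (fun k hk => FracCN.one_le_mittagLeffler hα (hz k hk))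
    (fun i j hij hj => FracCN.mittagLeffler_mono hα (hz i (hij.trans hj))
      (mul_le_mul_of_nonneg_left (Real.rpow_le_rpow (ht.nonneg (hij.trans hj))
        (ht.mono hij hj) hα.le) hl))
    -- The Mittag-Leffler argument uses `77/4 = 4 · 77/16`, so that the factor `4 L` with `L = κ² C`
    -- is exactly compensated.
    (fun k hk1 hk => by
      have := FracCN.mul_sum_complementary_mittagLeffler_le hα hα' ht hρ hl hk1 hk
      linarith)
    (fun k hk1 hk =>
      hu.sum_kernelA_semiH1_le hx hM hμ' hCM hC0.le hc hα hα' ht hρ hk1 hk)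
    (G := FracCN.semiH1 xl xr μ M (u 0) ^ 2 + FracCN.maxUpTo n hn1 (fun k =>
      ∑ j ∈ Finset.Icc 1 k, FracCN.complementary (FracCN.kernelA α t) k (k - j) *
        FracCN.sourceSq xl xr f α t M j))
    (le_add_of_nonneg_right hmax0) hn fun k hk1 hk => add_le_add le_rfl (hmax k hk1 hk)
  have h2 := mul_le_mul_of_nonneg_left 
    (add_le_add (le_refl (FracCN.semiH1 xl xr μ M (u 0) ^ 2)) hmax3)
    (show 0 ≤ 2 * FracCN.mittagLeffler α (77 / 4 * κ ^ 2 * C * t n ^ α) by linarith)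
  refine ⟨h1, h2, ?_⟩
  have h3 := hCM (u n) (hu.boundary n hn)
  rw [FracCN.normH1_sq, FracCN.normH1_sq]
  calc _ ≤ (1 + C) * FracCN.semiH1 xl xr μ M (u n) ^ 2 := by linarith
    _ ≤ (1 + C) * (2 * FracCN.mittagLeffler α (77 / 4 * κ ^ 2 * C * t n ^ α) *
          ((FracCN.normL2 xl xr M (u 0) ^ 2 + FracCN.semiH1 xl xr μ M (u 0) ^ 2) +
            11 / 4 * Real.Gamma (1 - α) *
              FracCN.maxUpTo n hn1 (fun k => t k ^ α * FracCN.sourceSq xl xr f α t M k))) := by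
        refine mul_le_mul_of_nonneg_left ((h1.trans h2).trans ?_) (by linarith)
        refine mul_le_mul_of_nonneg_left ?_ (by linarith)
        linarith [sq_nonneg (FracCN.normL2 xl xr M (u 0))]
    _ = _ := by ring
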